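/- **Model.** A source multicasts packets $s_1,s_2,\dots$ to two users $U_1,U_2$ over slotted erasure channels: in each slot $U_i$ receives the transmission with probability $p_i\in[0,1]$, and all these events (over slots and users) are independent. Before each slot the source knows all past erasures. Initially nothing is decoded. Let $r_i(n)$ (or $r_i$) be the index of the earliest packet that $U_i$ has not decoded after $n$ slots, $r_{\max}=\max(r_1,r_2)$, $r_{\min}=\min(r_1,r_2)$; when $r_1\ne r_2$ the user with the larger $r_i$ is the leader and the other the lagger. The number of gaps of $U_i$ is the number of its undecoded packets with index less than $r_{\max}$, and the state index is the number of gaps of $U_2$ minus that of $U_1$. The system is in an advantage state if $r_1\neq r_2$ and the lagger, but not the leader, has decoded $s_{r_{\max}}$. Under the greedy scheme the source sends $s_{r_{\max}}\oplus s_{r_{\min}}$ in advantage states and $s_{r_{\max}}$ otherwise. For integers $N,M\ge1$, the $(N,M)$ code follows the greedy scheme, except that in non-advantage states with index $\ge N$ or $\le -M$ it sends $s_{r_{\min}}$. For a given scheme, the throughput and the smoothness index of $U_i$ are the limits in probability $$\tau_i=\lim_{n\to\infty}\frac{r_i(n)}{n},\qquad \sigma_i=\lim_{n\to\infty}\frac1n\sum_{k=1}^n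 \mathbf 1\big(r_i(k)>r_i(k-1)\big),$$ where these exist and are constant. **Claim (time-sharing).** Let $R$ be a positive integer, let $N_r,M_r\ge1$ be integers and $0\le x_r\le 1$ real numbers ($r=1,\dots,R$) with $\sum_{r=1}^R x_r=1$. For every integer $W\ge1$ consider a scheme that splits time into consecutive windows of $W$ slots and splits every window, in the same way, into $R$ consecutive blocks, where the $r$-th block consists of $x_rW$ slots (rounded up or down to an integer if necessary, the block lengths adding up to $W$), and in the slots of the $r$-th block the $(N_r,M_r)$ code is applied to the current decoding state. Then for each user $i\in\{1,2\}$ the throughput and smoothness index $(\tau_i^{(r)},\sigma_i^{(r)})$ of each $(N_r,M_r)$ code exist, the throughput and smoothness index $(\tau_i(W),\sigma_i(W))$ of the time-sharing scheme exist for every $W\ge1$, and $$\lim_{W\to\infty}\big(\tau_i(W),\sigma_i(W)\big)=\Big(\sum_{r=1}^R x_r\,\tau_i^{(r)},\ \sum_{r=1}^R x_r\,\sigma_i^{(r)}\Big).$$ -/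

import Mathlib

open MeasureTheory ProbabilityTheory Filter Topology

namespace InOrderMulticast

/-- The decoded packets of the two users: `D i` is the set of indices of the packets that user `i`
has decoded. Packets are numbered `1, 2, 3, …`; the users `U₁`, `U₂` are `0, 1 : Fin 2`. -/
abbrev Decoded : Type := Fin 2 → Finset ℕ

theorem exists_undecoded (D : Finset ℕ) : ∃ k, 1 ≤ k ∧ k ∉ D := by
  obtain ⟨k, hk⟩ := Infinite.exists_notMem_finset (insert 0 D)
  rw [Finset.mem_insert, not_or] at hk
  exact ⟨k, Nat.one_le_iff_ne_zero.mpr hk.1, hk.2⟩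

/-- Index of the required packet: the earliest undecoded one. -/
def required (D : Finset ℕ) : ℕ := Nat.find (exists_undecoded D)

def rMax (D : Decoded) : ℕ := max (required (D 0)) (required (D 1))

def rMin (D : Decoded) : ℕ := min (required (D 0)) (required (D 1))

/-- Number of gaps of user `i`: undecoded packets with index less than `rMax`. -/
def gaps (D : Decoded) (i : Fin 2) : ℕ :=
  ((Finset.Ico 1 (rMax D)).filter (fun k => k ∉ D i)).card

/-- State index: the number of gaps of `U₂` minus that of `U₁`. -/
def stateIndex (D : Decoded) : ℤ := (gaps D 1 : ℤ) - (gaps D 0 : ℤ)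

/-- Advantage state: the lagger has decoded the required packet of the leader (which has index
`rMax`), but the leader has not. -/
def Advantage (D : Decoded) : Prop :=
  ∃ lagger leader : Fin 2, required (D lagger) < required (D leader) ∧
    rMax D ∈ D lagger ∧ rMax D ∉ D leader

instance (D : Decoded) : Decidable (Advantage D) := by
  unfold Advantage
  infer_instance

/-- Greedy coding. A transmission is the set of indices of the packets whose exclusive-or is sent. -/
def greedy (D : Decoded) : Finset ℕ :=
  if Advantage D then {rMax D, rMin D} else {rMax D}

/-- The `(N, M)` multicast code: greedy coding, except in the (non-advantage) states `i ≥ N` or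
`i ≤ -M`, where the required packet of the lagger is sent. -/
def multicast (N M : ℕ) (D : Decoded) : Finset ℕ :=
  if ¬ Advantage D ∧ ((N : ℤ) ≤ stateIndex D ∨ stateIndex D ≤ -(M : ℤ)) then {rMin D}
  else greedy D

/-- Decoding at a user who has decoded exactly the packets in `D` and receives the exclusive-or of
the packets in `S`: if exactly one packet of `S` is unknown, it becomes known; if there is none, the
combination is redundant. By `multicast_instantly_decodable`, two or more unknown packets never
occur here, so that no undecodable combination would ever have to be stored. -/
def decode (D S : Finset ℕ) : Finset ℕ :=
  if (S \ D).card = 1 then D ∪ S else D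

theorem mem_of_lt_required {D : Finset ℕ} {k : ℕ} (h1 : 1 ≤ k) (h : k < required D) : k ∈ D := by
  by_contra hk
  exact Nat.find_min (exists_undecoded D) h ⟨h1, hk⟩

theorem one_le_required (D : Finset ℕ) : 1 ≤ required D :=
  (Nat.find_spec (exists_undecoded D)).1

theorem multicast_instantly_decodable (N M : ℕ) (D : Decoded) (i : Fin 2) :
    (multicast N M D \ D i).card ≤ 1 := by
  have single : ∀ k : ℕ, (({k} : Finset ℕ) \ D i).card ≤ 1 := fun k =>
    (Finset.card_le_card Finset.sdiff_subset).trans (Finset.card_singleton k).le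
  have pair : ∀ k l : ℕ, (k ∈ D i ∨ l ∈ D i) → (({k, l} : Finset ℕ) \ D i).card ≤ 1 := by
    rintro k l (h | h)
    · rw [Finset.insert_sdiff_of_mem _ h]
      exact single l
    · rw [Finset.pair_comm, Finset.insert_sdiff_of_mem _ h]
      exact single k
  unfold multicast greedy
  split_ifs with h1 h2
  · exact single _
  · obtain ⟨a, b, hab, ha, -⟩ := h2
    apply pair
    by_cases hi : i = a
    · left
      rw [hi]
      exact ha
    · right
      have hib : i = b := by
        have : a ≠ b := by
          rintro rfl
          exact lt_irrefl _ hab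
        omega
      apply mem_of_lt_required
      · exact le_min (one_le_required _) (one_le_required _)
      · rw [hib]
        refine lt_of_le_of_lt ?_ hab
        unfold rMin
        fin_cases a
        · exact min_le_left _ _
        · exact min_le_right _ _
  · exact single _

/-- The decoded packets after `n` slots, when nothing is decoded at the start. In slot `t + 1`
the source sends `code t D`, where `D` describes the packets decoded by then (known to the source
by feedback), and user `i` receives it if and only if `e (t, i) = true`. -/
def decodedAfter (code : ℕ → Decoded → Finset ℕ) (e : ℕ × Fin 2 → Bool) : ℕ → Decoded
  | 0 => fun _ => ∅
  | t + 1 => fun i =>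
      if e (t, i) = true then
        decode (decodedAfter code e t i) (code t (decodedAfter code e t))
      else decodedAfter code e t i

/-- `r_i(n)`: index of the required packet of user `i` after `n` slots. -/
def requiredAfter (code : ℕ → Decoded → Finset ℕ) (e : ℕ × Fin 2 → Bool) (i : Fin 2) (n : ℕ) : ℕ :=
  required (decodedAfter code e n i)

variable {Ω : Type*} [MeasurableSpace Ω]

/-- Erasure channels, i.i.d. over slots and independent across users: `E (t, i)` is the event that
user `i` successfully receives the transmission of slot `t + 1`, of probability `p i`. -/
structure IsErasureChannel (μ : Measure Ω) (p : Fin 2 → ℝ) (E : ℕ × Fin 2 → Ω → Bool) : Prop where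
  measurable : ∀ a, Measurable (E a)
  indep : iIndepFun E μ
  prob : ∀ t i, μ.real {ω | E (t, i) ω = true} = p i

/-- `τ` is the throughput of user `i`: `r_i(n) / n → τ` in probability. -/
def HasThroughput (μ : Measure Ω) (E : ℕ × Fin 2 → Ω → Bool) (code : ℕ → Decoded → Finset ℕ)
    (i : Fin 2) (τ : ℝ) : Prop :=
  TendstoInMeasure μ
    (fun (n : ℕ) ω => (requiredAfter code (fun a => E a ω) i n : ℝ) / n) atTop (fun _ => τ)

/-- `σ` is the smoothness index of user `i`: the fraction of the first `n` slots in which `r_i`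
increases tends to `σ` in probability. -/
def HasSmoothness (μ : Measure Ω) (E : ℕ × Fin 2 → Ω → Bool) (code : ℕ → Decoded → Finset ℕ)
    (i : Fin 2) (σ : ℝ) : Prop :=
  TendstoInMeasure μ
    (fun (n : ℕ) ω =>
      (∑ k ∈ Finset.range n,
        if requiredAfter code (fun a => E a ω) i k < requiredAfter code (fun a => E a ω) i (k + 1)
        then (1 : ℝ) else 0) / n) atTop (fun _ => σ)

/-- `s t` is the number of the code used in slot `t + 1` under time-sharing with windows of `W`
slots and weights `x`: every window is split, in the same way, into consecutive blocks, the `r`-th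
of which consists of `x r * W` slots (rounded up or down if this is not an integer) and uses the
code with number `r`. -/
def IsTimeSharing {R : ℕ} (W : ℕ) (x : Fin R → ℝ) (s : ℕ → Fin R) : Prop :=
  ∃ len : Fin R → ℕ, ∑ r, len r = W ∧ (∀ r, |(len r : ℝ) - x r * W| < 1) ∧
    ∀ t, ∑ q ∈ Finset.Iio (s t), len q ≤ t % W ∧ t % W < ∑ q ∈ Finset.Iic (s t), len q

end InOrderMulticast

open InOrderMulticast

/-! The decoding state reduces to a small chain. One user, the leader, has decoded exactly the
packets below some `front`; the other has decoded the same packets except some holes, plus possibly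
`front` itself. All events of interest depend only on the leader's identity, the number of holes and
the advantage flag. Holes are created only below the threshold in force, so their number stays
bounded by some `G`, and the state together with the slot number modulo `W` is a finite Markov
chain.

On a finite chain with a state accessible from everywhere, the Poisson equation has a solution
(`exists_poisson`). It writes a total reward as `n * c` plus a martingale with bounded increments
plus a bounded term, and Chebyshev's inequality gives convergence in probability
(`HasPoisson.tail`). For the smoothness index the reward is `gain`. For the throughput it is
`frontGain`: both required indices lie between `low` and `front`, and `low` lags only negligibly,
because the other user fills holes at a positive rate (`hasThroughput_of_hasPoisson`).

For time-sharing, the expected reward in each slot satisfies two telescoping identities: one with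
the potential of the whole scheme, one with the potential of the code in use. The second breaks only
at block changes, at most `R + 1` per window, each at a cost independent of `W`. Rounding the block
lengths also costs a bounded amount per window. So the rates differ by `O(1/W)`
(`IsTimeSharing.abs_sub_le`, `tendsto_timeSharing`).

Accessibility needs both reception probabilities positive and one of them below `1`; the remaining
channels are degenerate and are treated directly. -/

namespace InOrderMulticast

/-! ### The Poisson equation on a finite chain. -/

section Poisson

variable {Z A : Type*} [Fintype A] {w : A → ℝ} {step : Z → A → Z} {V : Set Z} {z₀ : Z}

/-- On a finite closed set of states from which `z₀` is accessible, a superharmonic function is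
minimal at `z₀`. -/
theorem superharmonic_min (hw : ∀ a, 0 ≤ w a) (hw1 : ∑ a, w a = 1) (hV : V.Finite)
    (hstep : ∀ z ∈ V, ∀ a, step z a ∈ V)
    (hreach : ∀ z ∈ V, Relation.ReflTransGen (fun y y' => ∃ a, 0 < w a ∧ step y a = y') z z₀)
    {h : Z → ℝ} (hsup : ∀ z ∈ V, ∑ a, w a * h (step z a) ≤ h z) :
    ∀ z ∈ V, h z₀ ≤ h z := by
  intro z hz
  obtain ⟨y, hy, hmin⟩ := hV.exists_minimalFor h V ⟨z, hz⟩
  have hmin' : ∀ u ∈ V, h y ≤ h u := fun u hu => by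
    by_contra hlt
    exact hlt (hmin hu (le_of_not_ge hlt))
  -- The minimisers are closed under steps of positive weight: an average of values at least the
  -- minimum that does not exceed it has no larger term of positive weight.
  have key : ∀ u, Relation.ReflTransGen (fun y y' => ∃ a, 0 < w a ∧ step y a = y') y u →
      u ∈ V ∧ h u = h y := by
    intro u hu
    induction hu with
    | refl => exact ⟨hy, rfl⟩
    | @tail b b' _ hab ih =>
      obtain ⟨a, ha, rfl⟩ := hab
      refine ⟨hstep _ ih.1 a, ?_⟩
      have h1 : ∑ a, w a * (h (step b a) - h y) ≤ 0 := by
        simp only [mul_sub, Finset.sum_sub_distrib, ← Finset.sum_mul, hw1]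
        have := hsup _ ih.1
        linarith [ih.2]
      have h2 : ∀ a ∈ Finset.univ, 0 ≤ w a * (h (step b a) - h y) := fun a _ =>
        mul_nonneg (hw a) (sub_nonneg.mpr (hmin' _ (hstep _ ih.1 a)))
      have h3 := (Finset.sum_eq_zero_iff_of_nonneg h2).mp (le_antisymm h1 (Finset.sum_nonneg h2)) a
        (Finset.mem_univ a)
      rcases mul_eq_zero.mp h3 with h4 | h4
      · exact absurd h4 ha.ne'
      · linarith
  rw [(key z₀ (hreach y hy)).2]
  exact hmin' z hz

/-- With `P` the averaging operator, `T h = h - P h + h z₀` is injective, hence surjective, and a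
solution of `T h = f` has `c = h z₀`. If `T h = 0`, then `P h - h` is the constant `h z₀`. According
to its sign, `h` or `-h` is superharmonic, hence minimal at `z₀`, and averaging there forces the
constant to vanish. Then `h` and `-h` are both minimal at `z₀`, so `h = 0`. -/
theorem exists_poisson (hw : ∀ a, 0 ≤ w a) (hw1 : ∑ a, w a = 1) (hV : V.Finite)
    (hstep : ∀ z ∈ V, ∀ a, step z a ∈ V) (hz₀ : z₀ ∈ V)
    (hreach : ∀ z ∈ V, Relation.ReflTransGen (fun y y' => ∃ a, 0 < w a ∧ step y a = y') z z₀)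
    (f : Z → ℝ) :
    ∃ (h : Z → ℝ) (c : ℝ), ∀ z ∈ V, f z + ∑ a, w a * h (step z a) - h z = c := by
  classical
  have := hV.to_subtype
  let st : V → A → V := fun z a => ⟨step z a, hstep z z.2 a⟩
  let T : (V → ℝ) →ₗ[ℝ] (V → ℝ) :=
    { toFun := fun h z => h z - ∑ a, w a * h (st z a) + h ⟨z₀, hz₀⟩
      map_add' := fun h h' => by
        funext z
        simp only [Pi.add_apply, mul_add, Finset.sum_add_distrib]
        ring
      map_smul' := fun r h => by
        funext z
        simp only [Pi.smul_apply, smul_eq_mul, RingHom.id_apply, mul_add, mul_sub, Finset.mul_sum]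
        congr 2
        exact Finset.sum_congr rfl fun a _ => by ring }
  let ext : (V → ℝ) → Z → ℝ := fun h z => if hz : z ∈ V then h ⟨z, hz⟩ else 0
  have hext : ∀ h (z : V), ext h z = h z := fun h z => by simp [ext]
  have hT : ∀ h (z : V), T h z = ext h z - ∑ a, w a * ext h (step z a) + ext h z₀ := by
    intro h z
    rw [hext, show ext h z₀ = h ⟨z₀, hz₀⟩ from hext h ⟨z₀, hz₀⟩]
    simp only [T, LinearMap.coe_mk, AddHom.coe_mk]
    congr 2
    exact Finset.sum_congr rfl fun a _ => by rw [← hext h (st z a)]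
  have hinj : Function.Injective T := by
    rw [injective_iff_map_eq_zero]
    intro h h0
    have h1 : ∀ z ∈ V, ∑ a, w a * ext h (step z a) = ext h z + ext h z₀ := fun z hz => by
      have := hT h ⟨z, hz⟩
      rw [h0] at this
      simp only [Pi.zero_apply] at this
      linarith
    have hneg : ∀ z, ∑ a, w a * -ext h (step z a) = -∑ a, w a * ext h (step z a) := fun z => by
      simp only [mul_neg, Finset.sum_neg_distrib]
    have avg : ∀ (g : Z → ℝ), (∀ z ∈ V, g z₀ ≤ g z) → g z₀ ≤ ∑ a, w a * g (step z₀ a) := by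
      intro g hg
      calc g z₀ = ∑ a, w a * g z₀ := by rw [← Finset.sum_mul, hw1, one_mul]
        _ ≤ _ := Finset.sum_le_sum fun a _ =>
          mul_le_mul_of_nonneg_left (hg _ (hstep _ hz₀ a)) (hw a)
    have h2 : ext h z₀ = 0 := by
      rcases le_total (ext h z₀) 0 with h3 | h3
      · have h4 := avg (ext h) (superharmonic_min hw hw1 hV hstep hreach
          (fun z hz => by linarith [h1 z hz]))
        linarith [h1 z₀ hz₀]
      · have h4 := avg (fun z => -ext h z) (superharmonic_min hw hw1 hV hstep hreach
          (h := fun z => -ext h z) (fun z hz => by rw [hneg]; linarith [h1 z hz]))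
        rw [hneg] at h4
        linarith [h1 z₀ hz₀]
    funext z
    have h3 := superharmonic_min hw hw1 hV hstep hreach (h := ext h)
      (fun z hz => by linarith [h1 z hz]) z z.2
    have h4 := superharmonic_min hw hw1 hV hstep hreach (h := fun z => -ext h z)
      (fun z hz => by rw [hneg]; linarith [h1 z hz]) z z.2
    rw [← hext h z]
    simp only [Pi.zero_apply]
    linarith
  obtain ⟨h, hh⟩ := LinearMap.injective_iff_surjective.mp hinj (fun z => f z)
  refine ⟨ext h, ext h z₀, fun z hz => ?_⟩
  have := hT h ⟨z, hz⟩
  rw [hh] at this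
  simp only at this
  linarith

/-- If `c ≤ 0`, then `h` is superharmonic, so minimal at `z₀`, and the equation at `z₀` gives `c ≥ f
z₀ > 0`. -/
theorem poisson_pos (hw : ∀ a, 0 ≤ w a) (hw1 : ∑ a, w a = 1) (hV : V.Finite)
    (hstep : ∀ z ∈ V, ∀ a, step z a ∈ V) (hz₀ : z₀ ∈ V)
    (hreach : ∀ z ∈ V, Relation.ReflTransGen (fun y y' => ∃ a, 0 < w a ∧ step y a = y') z z₀)
    {f h : Z → ℝ} {c : ℝ} (hf : ∀ z ∈ V, 0 ≤ f z) (hf₀ : 0 < f z₀)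
    (hh : ∀ z ∈ V, f z + ∑ a, w a * h (step z a) - h z = c) : 0 < c := by
  by_contra hc
  have h1 := superharmonic_min hw hw1 hV hstep hreach (h := h)
    (fun z hz => by linarith [hh z hz, hf z hz])
  have h2 : h z₀ ≤ ∑ a, w a * h (step z₀ a) :=
    calc h z₀ = ∑ a, w a * h z₀ := by rw [← Finset.sum_mul, hw1, one_mul]
      _ ≤ _ := Finset.sum_le_sum fun a _ =>
        mul_le_mul_of_nonneg_left (h1 _ (hstep _ hz₀ a)) (hw a)
  linarith [hh z₀ hz₀]

end Poisson
end InOrderMulticast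

/-! ### Configurations: a leader without gaps and a user with holes. -/

namespace InOrderMulticast

def other (a : Fin 2) : Fin 2 := a + 1

theorem other_ne (a : Fin 2) : other a ≠ a := by revert a; decide

theorem other_other (a : Fin 2) : other (other a) = a := by revert a; decide

theorem eq_or_eq_other (a i : Fin 2) : i = a ∨ i = other a := by revert a i; decide

/-- The decoded packets in terms of a leader, who has decoded the packets below `front`, and of the
holes of the other user; `adv` records whether the latter has decoded the packet `front`. -/
structure Config where
  lead : Fin 2
  front : ℕ
  holes : Finset ℕ
  adv : Bool

/-- Leader, number of holes of the other user, and advantage flag. -/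
abbrev State : Type := Fin 2 × ℕ × Bool

namespace Config

def state (c : Config) : State := (c.lead, c.holes.card, c.adv)

/-- The required packet of the user other than the leader. -/
def low (c : Config) : ℕ := if h : c.holes.Nonempty then c.holes.min' h else c.front

/-- A tie is a configuration without holes and without advantage; its leader label is then
arbitrary. -/
structure Valid (c : Config) : Prop where
  one_le : 1 ≤ c.front
  holes_lt : ∀ k ∈ c.holes, 1 ≤ k ∧ k < c.front
  nonempty : c.adv = true → c.holes.Nonempty

def decoded (c : Config) : Decoded := fun i =>
  if i = c.lead then Finset.Ico 1 c.front
  else (Finset.Ico 1 c.front \ c.holes) ∪ (if c.adv then {c.front} else ∅)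

/-- `θ i` is the threshold in force while user `i` leads: `θ 0` plays the role of `N` and `θ 1` that
of `M`. -/
def sent (θ : Fin 2 → ℕ) (c : Config) : Finset ℕ :=
  if c.adv then {c.front, c.low}
  else if θ c.lead ≤ c.holes.card then {c.low} else {c.front}

/-- Update by one slot, in which user `i` receives the transmission iff `e i = true`. -/
def next (θ : Fin 2 → ℕ) (c : Config) (e : Fin 2 → Bool) : Config :=
  if c.adv then
    if e c.lead then
      ⟨c.lead, c.front + 1, if e (other c.lead) then c.holes.erase c.low else c.holes, false⟩
    else if e (other c.lead) then
      if c.holes.card ≤ 1 then ⟨other c.lead, c.front + 1, {c.front}, false⟩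
      else ⟨c.lead, c.front, c.holes.erase c.low, true⟩
    else c
  else if θ c.lead ≤ c.holes.card then
    if e (other c.lead) then ⟨c.lead, c.front, c.holes.erase c.low, false⟩ else c
  else if e c.lead then
    ⟨c.lead, c.front + 1, if e (other c.lead) then c.holes else insert c.front c.holes, false⟩
  else if e (other c.lead) then
    if c.holes.card = 0 then ⟨other c.lead, c.front + 1, {c.front}, false⟩
    else ⟨c.lead, c.front, c.holes, true⟩
  else c

end Config

/-- The state component of `Config.next`. -/
def State.next (θ : Fin 2 → ℕ) (s : State) (e : Fin 2 → Bool) : State :=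
  if s.2.2 then
    if e s.1 then (s.1, if e (other s.1) then s.2.1 - 1 else s.2.1, false)
    else if e (other s.1) then
      if s.2.1 ≤ 1 then (other s.1, 1, false) else (s.1, s.2.1 - 1, true)
    else s
  else if θ s.1 ≤ s.2.1 then
    if e (other s.1) then (s.1, s.2.1 - 1, false) else s
  else if e s.1 then
    (s.1, if e (other s.1) then s.2.1 else s.2.1 + 1, false)
  else if e (other s.1) then
    if s.2.1 = 0 then (other s.1, 1, false) else (s.1, s.2.1, true)
  else s

/-- Whether the leader decodes its required packet. -/
def leadGain (θ : Fin 2 → ℕ) (s : State) (e : Fin 2 → Bool) : ℕ :=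
  if e s.1 = true ∧ (s.2.2 = true ∨ s.2.1 < θ s.1) then 1 else 0

/-- Whether the user other than the leader decodes its required packet. -/
def lagGain (θ : Fin 2 → ℕ) (s : State) (e : Fin 2 → Bool) : ℕ :=
  if e (other s.1) = true ∧ (s.2.2 = true ∨ θ s.1 ≤ s.2.1 ∨ s.2.1 = 0) then 1 else 0

/-- Whether the required packet of user `i` changes. -/
def gain (i : Fin 2) (θ : Fin 2 → ℕ) (s : State) (e : Fin 2 → Bool) : ℕ :=
  if i = s.1 then leadGain θ s e else lagGain θ s e

/-- Increment of the larger one of the indices of the required packets. -/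
def frontGain (θ : Fin 2 → ℕ) (s : State) (e : Fin 2 → Bool) : ℕ :=
  if leadGain θ s e = 1 ∨ (lagGain θ s e = 1 ∧ ((s.2.2 = true ∧ s.2.1 ≤ 1) ∨ s.2.1 = 0))
  then 1 else 0

namespace Config

variable {c : Config} {θ : Fin 2 → ℕ}

theorem low_mem (h : c.holes.Nonempty) : c.low ∈ c.holes := by
  unfold low
  rw [dif_pos h]
  exact Finset.min'_mem _ _

theorem low_le {k : ℕ} (h : k ∈ c.holes) : c.low ≤ k := by
  unfold low
  rw [dif_pos ⟨k, h⟩]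
  exact Finset.min'_le _ _ h

theorem low_of_empty (h : c.holes = ∅) : c.low = c.front := by
  unfold low
  rw [dif_neg (by simp [h])]

theorem Valid.low_le_front (hc : c.Valid) : c.low ≤ c.front := by
  rcases c.holes.eq_empty_or_nonempty with h | h
  · exact (low_of_empty h).le
  · exact (hc.holes_lt _ (low_mem h)).2.le

theorem Valid.one_le_low (hc : c.Valid) : 1 ≤ c.low := by
  rcases c.holes.eq_empty_or_nonempty with h | h
  · exact (low_of_empty h) ▸ hc.one_le
  · exact (hc.holes_lt _ (low_mem h)).1

theorem required_eq {D : Finset ℕ} {m : ℕ} (h1 : 1 ≤ m) (hm : m ∉ D)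
    (h : ∀ k, 1 ≤ k → k < m → k ∈ D) : required D = m := by
  unfold required
  rw [Nat.find_eq_iff]
  exact ⟨⟨h1, hm⟩, fun k hk h' => h'.2 (h k h'.1 hk)⟩

theorem decoded_lead (c : Config) : c.decoded c.lead = Finset.Ico 1 c.front := by
  simp [decoded]

theorem decoded_lag (c : Config) : c.decoded (other c.lead) =
    (Finset.Ico 1 c.front \ c.holes) ∪ (if c.adv then {c.front} else ∅) := by
  simp [decoded, other_ne]

theorem Valid.required_lead (hc : c.Valid) : required (c.decoded c.lead) = c.front := by
  apply required_eq hc.one_le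
  · simp [decoded]
  · intro k h1 h2
    simp [decoded, h1, h2]

theorem Valid.required_lag (hc : c.Valid) : required (c.decoded (other c.lead)) = c.low := by
  rw [decoded_lag]
  apply required_eq hc.one_le_low
  · rcases c.holes.eq_empty_or_nonempty with h | h
    · rw [low_of_empty h]
      have : c.adv = false := by
        by_contra h'
        have := hc.nonempty (by simpa using h')
        simp [h] at this
      simp [this]
    · have h1 := low_mem h
      have h2 := hc.holes_lt _ h1
      split_ifs <;> simp [h1]
      omega
  · intro k h1 h2
    have h3 : k ∉ c.holes := fun h => absurd (low_le h) (by omega)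
    have := hc.low_le_front
    simp only [Finset.mem_union, Finset.mem_sdiff, Finset.mem_Ico]
    left
    exact ⟨⟨h1, by omega⟩, h3⟩

theorem Valid.rMax_eq (hc : c.Valid) : rMax c.decoded = c.front := by
  have h1 := hc.required_lead
  have h2 := hc.required_lag
  have h3 := hc.low_le_front
  unfold rMax
  generalize c.lead = a at *
  fin_cases a
  · simp only [Fin.zero_eta, show other 0 = 1 from rfl] at h1 h2
    rw [h1, h2]; omega
  · simp only [Fin.mk_one, show other 1 = 0 from rfl] at h1 h2
    rw [h1, h2]; omega

theorem Valid.rMin_eq (hc : c.Valid) : rMin c.decoded = c.low := by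
  have h1 := hc.required_lead
  have h2 := hc.required_lag
  have h3 := hc.low_le_front
  unfold rMin
  generalize c.lead = a at *
  fin_cases a
  · simp only [Fin.zero_eta, show other 0 = 1 from rfl] at h1 h2
    rw [h1, h2]; omega
  · simp only [Fin.mk_one, show other 1 = 0 from rfl] at h1 h2
    rw [h1, h2]; omega

theorem Valid.gaps_lead (hc : c.Valid) : gaps c.decoded c.lead = 0 := by
  unfold gaps
  rw [hc.rMax_eq, decoded_lead, Finset.card_eq_zero, Finset.filter_eq_empty_iff]
  simp

theorem Valid.gaps_lag (hc : c.Valid) : gaps c.decoded (other c.lead) = c.holes.card := by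
  unfold gaps
  rw [hc.rMax_eq, decoded_lag]
  congr 1
  ext k
  have := hc.holes_lt k
  split_ifs <;> simp <;> grind

theorem Valid.advantage_iff (hc : c.Valid) : Advantage c.decoded ↔ c.adv = true := by
  unfold Advantage
  rw [hc.rMax_eq]
  constructor
  · rintro ⟨b, a, h1, h2, -⟩
    rcases eq_or_eq_other c.lead b with rfl | rfl
    · simp [decoded_lead] at h2
    · by_contra h
      simp [decoded_lag, h] at h2
  · intro h
    refine ⟨other c.lead, c.lead, ?_, ?_, ?_⟩
    · rw [hc.required_lead, hc.required_lag]
      exact (hc.holes_lt _ (low_mem (hc.nonempty h))).2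
    · simp [decoded_lag, h]
    · simp [decoded_lead]

theorem Valid.multicast_eq (hc : c.Valid) (hθ : ∀ i, 1 ≤ θ i) :
    multicast (θ 0) (θ 1) c.decoded = c.sent θ := by
  -- The leader has no gaps, so the state index is plus or minus the number of holes; as thresholds
  -- are positive, only the inequality belonging to the leader can hold.
  have key : ((θ 0 : ℤ) ≤ stateIndex c.decoded ∨ stateIndex c.decoded ≤ -(θ 1 : ℤ)) ↔
      θ c.lead ≤ c.holes.card := by
    have h1 := hc.gaps_lead
    have h2 := hc.gaps_lag
    have h3 := hθ 0
    have h4 := hθ 1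
    unfold stateIndex
    generalize c.lead = a at *
    fin_cases a
    · simp only [Fin.zero_eta, show other 0 = 1 from rfl] at h1 h2 ⊢
      omega
    · simp only [Fin.mk_one, show other 1 = 0 from rfl] at h1 h2 ⊢
      omega
  unfold multicast greedy sent
  simp only [key, hc.advantage_iff, hc.rMax_eq, hc.rMin_eq]
  by_cases h : c.adv = true <;> simp [h]

theorem decode_eq_union {D S : Finset ℕ} (h : (S \ D).card ≤ 1) : decode D S = D ∪ S := by
  unfold decode
  split_ifs with h1
  · rfl
  · have : (S \ D).card = 0 := by omega
    rw [Finset.card_eq_zero, Finset.sdiff_eq_empty_iff_subset] at this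
    exact (Finset.union_eq_left.mpr this).symm

end Config
end InOrderMulticast

/-! ### One slot of the configuration dynamics. -/

namespace InOrderMulticast
namespace Config

variable {c : Config} {θ : Fin 2 → ℕ}

theorem Valid.next (hc : c.Valid) (e : Fin 2 → Bool) : (c.next θ e).Valid := by
  have h1 := hc.one_le
  have h2 := hc.holes_lt
  have h3 := hc.nonempty
  have hlow : c.holes.Nonempty → c.low ∈ c.holes := low_mem
  have hF : 1 ≤ c.holes.card → c.holes.Nonempty := Finset.card_pos.mp
  have h4 : c.adv = true → ¬ c.holes.card ≤ 1 → (c.holes.erase c.low).Nonempty := by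
    intro h h'
    rw [← Finset.card_pos, Finset.card_erase_of_mem (hlow (h3 h))]
    omega
  unfold Config.next
  generalize e c.lead = x
  generalize e (other c.lead) = y
  generalize θ c.lead = K
  generalize c.low = l at *
  obtain ⟨a, m, F, v⟩ := c
  simp only at *
  split_ifs <;> constructor <;> simp <;> grind

theorem Valid.state_next (hc : c.Valid) (hθ : ∀ i, 1 ≤ θ i) (e : Fin 2 → Bool) :
    (c.next θ e).state = c.state.next θ e := by
  have h1 := hc.one_le
  have h2 := hc.holes_lt
  have h3 := hc.nonempty
  have hlow : c.holes.Nonempty → (c.holes.erase c.low).card = c.holes.card - 1 :=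
    fun h => Finset.card_erase_of_mem (low_mem h)
  have hm : (insert c.front c.holes).card = c.holes.card + 1 :=
    Finset.card_insert_of_notMem fun h => absurd (h2 _ h).2 (lt_irrefl _)
  have hF : 1 ≤ c.holes.card → c.holes.Nonempty := Finset.card_pos.mp
  have h4 := hθ c.lead
  unfold Config.next State.next state
  generalize e c.lead = x
  generalize e (other c.lead) = y
  generalize θ c.lead = K at *
  generalize c.low = l at *
  obtain ⟨a, m, F, v⟩ := c
  simp only at *
  split_ifs <;> simp <;> grind

theorem Valid.front_next (hc : c.Valid) (hθ : ∀ i, 1 ≤ θ i) (e : Fin 2 → Bool) :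
    (c.next θ e).front = c.front + frontGain θ c.state e := by
  have h3 := hc.nonempty
  have h4 := hθ c.lead
  unfold Config.next frontGain leadGain lagGain state
  generalize e c.lead = x
  generalize e (other c.lead) = y
  generalize θ c.lead = K at *
  generalize c.low = l at *
  obtain ⟨a, m, F, v⟩ := c
  simp only at *
  split_ifs <;> simp <;> grind

/-- This makes configurations an exact simulation of the decoding process: by instant decodability,
reception is a plain union. When the last hole is filled in an advantage configuration, or the lone
receiver of a tie moves ahead, the roles are exchanged and the old leader is left with the single
hole `front`. -/
theorem Valid.decoded_next (hc : c.Valid) (hθ : ∀ i, 1 ≤ θ i) (e : Fin 2 → Bool) (i : Fin 2) :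
    (c.next θ e).decoded i = if e i = true then c.decoded i ∪ c.sent θ else c.decoded i := by
  have h1 := hc.one_le
  have h2 := hc.holes_lt
  have h3 := hc.nonempty
  have hlow : c.holes.Nonempty → c.low ∈ c.holes := low_mem
  have hF : 1 ≤ c.holes.card → c.holes.Nonempty := Finset.card_pos.mp
  have hF1 : c.holes.card ≤ 1 → ∀ k ∈ c.holes, k = c.low :=
    fun h k hk => Finset.card_le_one.mp h k hk _ (hlow ⟨k, hk⟩)
  have hF0 : c.holes.card = 0 → ∀ k, k ∉ c.holes := fun h k hk => by
    rw [Finset.card_eq_zero.mp h] at hk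
    exact absurd hk (Finset.notMem_empty k)
  have h4 := hθ c.lead
  have h5 : other c.lead ≠ c.lead := other_ne c.lead
  have h6 := other_other c.lead
  unfold Config.next sent decoded
  rcases eq_or_eq_other c.lead i with rfl | rfl
  all_goals
    generalize e c.lead = x
    generalize e (other c.lead) = y
    generalize θ c.lead = K at *
    generalize c.low = l at *
    obtain ⟨a, m, F, v⟩ := c
    simp only at *
    generalize other a = b at *
    clear hc
    have h7 : F.Nonempty → 1 ≤ l ∧ l < m := fun h => h2 l (hlow h)
    ext k
    have h8 := h2 k
    have h9 := fun h => hF1 h k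
    have h10 := fun h => hF0 h k
    clear h2 hF1 hF0
    rcases v with _ | _
    · clear h3
      by_cases hK : K ≤ F.card
      · have h11 := hF (h4.trans hK)
        have h12 := hlow h11
        have h13 := h7 h11
        clear h7 hF hlow h11
        rcases x with _ | _ <;> rcases y with _ | _ <;> simp [hK, h5] <;> grind
      · clear h7 hF hlow
        rcases x with _ | _ <;> rcases y with _ | _ <;> by_cases h0 : F.card = 0 <;>
          simp only [hK, h0, h5] <;> simp [h5] <;> grind
    · have h11 := h3 rfl
      have h12 := hlow h11
      have h13 := h7 h11
      clear h7 hF hlow h11 h3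
      rcases x with _ | _ <;> rcases y with _ | _ <;> by_cases h0 : F.card ≤ 1 <;>
        simp only [h0, h5] <;> simp [h5, h5.symm] <;> grind

end Config
end InOrderMulticast

/-! ### Increments of the required packets, and whole trajectories. -/

namespace InOrderMulticast

theorem required_notMem (D : Finset ℕ) : required D ∉ D := (Nat.find_spec (exists_undecoded D)).2

theorem required_lt_iff {D D' : Finset ℕ} (h : D ⊆ D') :
    required D < required D' ↔ required D ∈ D' := by
  constructor
  · exact mem_of_lt_required (one_le_required D)
  · intro h1
    refine lt_of_le_of_ne ?_ fun h2 => required_notMem D' (h2 ▸ h1)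
    exact Nat.find_min' _ ⟨one_le_required D', fun h2 => required_notMem D' (h h2)⟩

/-- A hole is added only below the leader's threshold, which is at most `G`; an exchange of roles
leaves one hole, whence `1 ≤ G`. -/
theorem State.next_card_le {θ : Fin 2 → ℕ} {G : ℕ} (hG : 1 ≤ G) (hθ : ∀ i, θ i ≤ G) {s : State}
    (hs : s.2.1 ≤ G) (e : Fin 2 → Bool) : (s.next θ e).2.1 ≤ G := by
  have := hθ s.1
  unfold State.next
  split_ifs <;> (try simp only) <;> omega

namespace Config

variable {c : Config} {θ : Fin 2 → ℕ}

theorem Valid.required_lt_next_iff (hc : c.Valid) (hθ : ∀ i, 1 ≤ θ i) (e : Fin 2 → Bool)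
    (i : Fin 2) : required (c.decoded i) < required ((c.next θ e).decoded i) ↔
      gain i θ c.state e = 1 := by
  rw [required_lt_iff, hc.decoded_next hθ]
  -- The required packet advances exactly when the user receives a combination containing it.
  · have h0 : ((required (c.decoded i) ∈ if e i = true then c.decoded i ∪ c.sent θ
        else c.decoded i) ↔ e i = true ∧ required (c.decoded i) ∈ c.sent θ) := by
      split_ifs with h <;> simp [required_notMem, h]
    rw [h0]
    have h1 := hc.low_le_front
    have h2 : c.holes.card ≠ 0 → c.low ≠ c.front := by
      intro h h'
      have := hc.holes_lt _ (low_mem (Finset.card_pos.mp (by omega)))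
      omega
    have h3 : c.holes.card = 0 → c.low = c.front := fun h => low_of_empty (Finset.card_eq_zero.mp h)
    rcases eq_or_eq_other c.lead i with rfl | rfl
    · rw [hc.required_lead]
      have := hθ c.lead
      unfold gain leadGain sent state
      simp only
      split_ifs <;> simp <;> grind
    · rw [hc.required_lag]
      unfold gain lagGain sent state
      simp only [other_ne]
      split_ifs <;> simp <;> grind
  · rw [hc.decoded_next hθ]
    split_ifs
    · exact Finset.subset_union_left
    · exact subset_rfl

def init : Config := ⟨0, 1, ∅, false⟩

theorem init_valid : init.Valid := ⟨le_rfl, by simp [init], by simp [init]⟩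

/-- The configuration after `n` slots, when thresholds `θ t` are used in slot `t + 1`. -/
def run (θ : ℕ → Fin 2 → ℕ) (e : ℕ × Fin 2 → Bool) : ℕ → Config
  | 0 => init
  | t + 1 => (run θ e t).next (θ t) (fun i => e (t, i))

end Config

namespace State

def run (θ : ℕ → Fin 2 → ℕ) (e : ℕ × Fin 2 → Bool) : ℕ → State
  | 0 => (0, 0, false)
  | t + 1 => (run θ e t).next (θ t) (fun i => e (t, i))

theorem run_card_le {θ : ℕ → Fin 2 → ℕ} {G : ℕ} (hG : 1 ≤ G) (hθ : ∀ t i, θ t i ≤ G)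
    (e : ℕ × Fin 2 → Bool) (n : ℕ) : (run θ e n).2.1 ≤ G := by
  induction n with
  | zero => exact Nat.zero_le G
  | succ n ih => exact next_card_le hG (hθ n) ih _

end State

namespace Config

variable {θ : ℕ → Fin 2 → ℕ}

theorem run_valid (θ : ℕ → Fin 2 → ℕ) (e : ℕ × Fin 2 → Bool) (n : ℕ) : (run θ e n).Valid := by
  induction n with
  | zero => exact init_valid
  | succ n ih => exact ih.next _

theorem run_state (hθ : ∀ t i, 1 ≤ θ t i) (e : ℕ × Fin 2 → Bool) (n : ℕ) :
    (run θ e n).state = State.run θ e n := by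
  induction n with
  | zero => rfl
  | succ n ih =>
    unfold run State.run
    rw [(run_valid θ e n).state_next (hθ n), ih]

theorem run_decoded (hθ : ∀ t i, 1 ≤ θ t i) (e : ℕ × Fin 2 → Bool) (n : ℕ) :
    decodedAfter (fun t => multicast (θ t 0) (θ t 1)) e n = (run θ e n).decoded := by
  induction n with
  | zero =>
    funext i
    simp [decodedAfter, run, init, decoded]
  | succ n ih =>
    funext i
    unfold decodedAfter run
    rw [(run_valid θ e n).decoded_next (hθ n), ih, (run_valid θ e n).multicast_eq (hθ n),
      decode_eq_union]
    rw [← (run_valid θ e n).multicast_eq (hθ n)]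
    exact multicast_instantly_decodable _ _ _ _

theorem run_front (hθ : ∀ t i, 1 ≤ θ t i) (e : ℕ × Fin 2 → Bool) (n : ℕ) :
    (run θ e n).front =
      1 + ∑ t ∈ Finset.range n, frontGain (θ t) (State.run θ e t) (fun i => e (t, i)) := by
  induction n with
  | zero => rfl
  | succ n ih =>
    rw [Finset.sum_range_succ, ← add_assoc, ← ih, ← run_state hθ]
    exact (run_valid θ e n).front_next (hθ n) _

theorem requiredAfter_eq (hθ : ∀ t i, 1 ≤ θ t i) (e : ℕ × Fin 2 → Bool) (i : Fin 2) (n : ℕ) :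
    requiredAfter (fun t => multicast (θ t 0) (θ t 1)) e i n = required ((run θ e n).decoded i) := by
  unfold requiredAfter
  rw [run_decoded hθ]

theorem requiredAfter_lt_succ_iff (hθ : ∀ t i, 1 ≤ θ t i) (e : ℕ × Fin 2 → Bool) (i : Fin 2)
    (n : ℕ) : requiredAfter (fun t => multicast (θ t 0) (θ t 1)) e i n <
      requiredAfter (fun t => multicast (θ t 0) (θ t 1)) e i (n + 1) ↔
      gain i (θ n) (State.run θ e n) (fun i => e (n, i)) = 1 := by
  rw [requiredAfter_eq hθ, requiredAfter_eq hθ, ← run_state hθ]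
  exact (run_valid θ e n).required_lt_next_iff (hθ n) _ i

theorem requiredAfter_le_front (hθ : ∀ t i, 1 ≤ θ t i) (e : ℕ × Fin 2 → Bool) (i : Fin 2)
    (n : ℕ) : requiredAfter (fun t => multicast (θ t 0) (θ t 1)) e i n ≤ (run θ e n).front := by
  rw [requiredAfter_eq hθ]
  have hc := run_valid θ e n
  rcases eq_or_eq_other (run θ e n).lead i with h | h
  · rw [h, hc.required_lead]
  · rw [h, hc.required_lag]
    exact hc.low_le_front

theorem low_le_requiredAfter (hθ : ∀ t i, 1 ≤ θ t i) (e : ℕ × Fin 2 → Bool) (i : Fin 2)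
    (n : ℕ) : (run θ e n).low ≤ requiredAfter (fun t => multicast (θ t 0) (θ t 1)) e i n := by
  rw [requiredAfter_eq hθ]
  have hc := run_valid θ e n
  rcases eq_or_eq_other (run θ e n).lead i with h | h
  · rw [h, hc.required_lead]
    exact hc.low_le_front
  · rw [h, hc.required_lag]

/-- New holes appear at `front`, hence not below `q`, and an exchange of roles leaves no hole below
`q`. While some hole lies below `q`, the lowest one does, and this is the one filled by a lag gain.
-/
theorem card_filter_next {c : Config} {θ : Fin 2 → ℕ} (hθ : ∀ i, 1 ≤ θ i)
    (e : Fin 2 → Bool) {q : ℕ} (hq : q ≤ c.front) :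
    ((c.next θ e).holes.filter (· < q) = ∅) ∨
      (((c.holes.filter (· < q)).Nonempty) ∧ ((c.next θ e).holes.filter (· < q)).card +
        lagGain θ c.state e ≤ (c.holes.filter (· < q)).card) := by
  have herase : (c.holes.filter (· < q)).Nonempty → ((c.holes.erase c.low).filter (· < q)).card + 1 =
      (c.holes.filter (· < q)).card := by
    rintro ⟨k, hk⟩
    rw [Finset.mem_filter] at hk
    rw [Finset.filter_erase, Finset.card_erase_add_one]
    rw [Finset.mem_filter]
    exact ⟨low_mem ⟨k, hk.1⟩, (low_le hk.1).trans_lt hk.2⟩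
  have hempty : c.holes.filter (· < q) = ∅ → (c.holes.erase c.low).filter (· < q) = ∅ := by
    intro h
    rw [Finset.filter_erase, h, Finset.erase_empty]
  have hins : (insert c.front c.holes).filter (· < q) = c.holes.filter (· < q) := by
    rw [Finset.filter_insert, if_neg (by omega)]
  have hsing : ({c.front} : Finset ℕ).filter (· < q) = ∅ := by
    rw [Finset.filter_singleton, if_neg (by omega)]
  have h0 : c.holes.card = 0 → c.holes.filter (· < q) = ∅ := fun h => by
    rw [Finset.card_eq_zero.mp h, Finset.filter_empty]
  have h4 := hθ c.lead
  unfold Config.next lagGain state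
  rcases (c.holes.filter (· < q)).eq_empty_or_nonempty with h | h
  · left
    split_ifs <;> simp only [h, hempty h, hins, hsing]
  · have h' := herase h
    have h'' : c.holes.card ≠ 0 := fun h1 => h.ne_empty (h0 h1)
    simp only [h, true_and]
    split_ifs <;> (try simp only [hins, hsing]) <;> grind

/-- While the packets below an earlier value of `front` are not all decoded by both users, each
packet decoded by the user other than the leader fills one of at most `G` holes. -/
theorem front_le_low_or_sum_lagGain_le {G : ℕ} (hG : 1 ≤ G) (hθ : ∀ t i, 1 ≤ θ t i)
    (hθG : ∀ t i, θ t i ≤ G) (e : ℕ × Fin 2 → Bool) (k d : ℕ) :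
    (run θ e k).front ≤ (run θ e (k + d)).low ∨
      ∑ t ∈ Finset.Ico k (k + d), lagGain (θ t) (State.run θ e t) (fun i => e (t, i)) ≤ G := by
  set q := (run θ e k).front with hq
  have hle : ∀ j, q ≤ (run θ e (k + j)).front := by
    intro j
    rw [hq, run_front hθ, run_front hθ]
    gcongr
    omega
  have key : ∀ j, (run θ e (k + j)).holes.filter (· < q) = ∅ ∨
      ((run θ e (k + j)).holes.filter (· < q)).card + ∑ t ∈ Finset.Ico k (k + j),
        lagGain (θ t) (State.run θ e t) (fun i => e (t, i)) ≤ G := by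
    intro j
    induction j with
    | zero =>
      right
      simp only [add_zero, Finset.Ico_self, Finset.sum_empty]
      have h1 := State.run_card_le hG hθG e k
      rw [← run_state hθ] at h1
      exact (Finset.card_filter_le _ _).trans h1
    | succ j ih =>
      rcases card_filter_next (hθ (k + j)) (fun i => e (k + j, i)) (hle j)
        with h | ⟨h1, h2⟩
      · exact Or.inl h
      · right
        have h3 := ih.resolve_left h1.ne_empty
        rw [run_state hθ] at h2
        rw [← add_assoc, Finset.sum_Ico_succ_top (by omega)]
        change ((((run θ e (k + j)).next (θ (k + j)) (fun i => e (k + j, i))).holes.filter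
          (· < q)).card + _) ≤ G
        omega
  rcases key d with h | h
  · left
    rcases (run θ e (k + d)).holes.eq_empty_or_nonempty with h1 | h1
    · rw [low_of_empty h1]
      exact hle d
    · by_contra h2
      have : (run θ e (k + d)).low ∈ (run θ e (k + d)).holes.filter (· < q) :=
        Finset.mem_filter.mpr ⟨low_mem h1, by omega⟩
      rw [h] at this
      exact absurd this (Finset.notMem_empty _)
  · exact Or.inr (by omega)

end Config
end InOrderMulticast

/-! ### Reception patterns and accessibility of a state. -/

namespace InOrderMulticast

/-- Probability of the reception pattern `e`. -/
noncomputable def weight (p : Fin 2 → ℝ) (e : Fin 2 → Bool) : ℝ :=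
  ∏ i, if e i = true then p i else 1 - p i

theorem weight_nonneg {p : Fin 2 → ℝ} (hp : ∀ i, 0 ≤ p i ∧ p i ≤ 1) (e : Fin 2 → Bool) :
    0 ≤ weight p e := by
  refine Finset.prod_nonneg fun i _ => ?_
  split_ifs
  · exact (hp i).1
  · linarith [(hp i).2]

theorem sum_weight (p : Fin 2 → ℝ) : ∑ e, weight p e = 1 := by
  have := Finset.prod_univ_sum (fun _ : Fin 2 => (Finset.univ : Finset Bool))
    (fun i b => if b = true then p i else 1 - p i)
  rw [Fintype.piFinset_univ] at this
  unfold weight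
  rw [← this]
  simp

theorem weight_both_pos {p : Fin 2 → ℝ} (hp : ∀ i, 0 < p i) : 0 < weight p (fun _ => true) := by
  unfold weight
  simpa using mul_pos (hp 0) (hp 1)

theorem weight_only_pos {p : Fin 2 → ℝ} {a : Fin 2} (ha : 0 < p a) (hb : p (other a) < 1) :
    0 < weight p (fun i => decide (i = a)) := by
  unfold weight
  refine Finset.prod_pos fun i _ => ?_
  rcases eq_or_eq_other a i with rfl | rfl
  · simpa using ha
  · simpa [other_ne] using hb

/-- One slot of the chain consisting of the state and the slot number modulo `W`. -/
def chainStep {W : ℕ} (θ : ZMod W → Fin 2 → ℕ) (z : State × ZMod W) (e : Fin 2 → Bool) :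
    State × ZMod W := (z.1.next (θ z.2) e, z.2 + 1)

/-- Two patterns of positive probability suffice: both users receive, or only `a` does. The target
has `a` leading with as many holes as its largest threshold `K`, so that receptions by `a` alone
leave the state unchanged and the slot number can be adjusted freely. -/
theorem chain_accessible {p : Fin 2 → ℝ} (hp : ∀ i, 0 < p i) {a : Fin 2} (hb : p (other a) < 1)
    {W : ℕ} [NeZero W] {θ : ZMod W → Fin 2 → ℕ} (hθ : ∀ φ i, 1 ≤ θ φ i) {φ₀ : ZMod W}
    (hmax : ∀ φ, θ φ a ≤ θ φ₀ a) (z : State × ZMod W) :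
    Relation.ReflTransGen (fun y y' => ∃ e, 0 < weight p e ∧ chainStep θ y e = y') z
      ((a, θ φ₀ a, false), 0) := by
  obtain ⟨s, φ⟩ := z
  set R : State → ZMod W → Prop := fun s φ => Relation.ReflTransGen
    (fun y y' => ∃ e, 0 < weight p e ∧ chainStep θ y e = y') (s, φ) ((a, θ φ₀ a, false), 0) with hR
  change R s φ
  have hboth : ∀ s φ, R (s.next (θ φ) fun _ => true) (φ + 1) → R s φ := fun s φ h =>
    Relation.ReflTransGen.head ⟨_, weight_both_pos hp, rfl⟩ h
  have honly : ∀ s φ, R (s.next (θ φ) fun i => decide (i = a)) (φ + 1) → R s φ := fun s φ h =>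
    Relation.ReflTransGen.head ⟨_, weight_only_pos (hp a) hb, rfl⟩ h
  have hr0 : R (a, θ φ₀ a, false) 0 := Relation.ReflTransGen.refl
  clear_value R
  clear hR
  set K := θ φ₀ a with hK
  -- Slot numbers are cyclic, so a property that passes from `φ + 1` to `φ` spreads from one slot
  -- number to all.
  have back : ∀ (P : ZMod W → Prop) (ψ : ZMod W), P ψ → (∀ φ, P (φ + 1) → P φ) → ∀ φ, P φ := by
    intro P ψ h0 h1 φ
    have : ∀ n : ℕ, P (ψ - n) := by
      intro n
      induction n with
      | zero => simpa using h0
      | succ n ih =>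
        apply h1
        convert ih using 1
        push_cast
        ring
    have h2 := this (ψ - φ).val
    rw [ZMod.natCast_zmod_val] at h2
    simpa using h2
  have r1 : ∀ φ, R (a, K, false) φ := by
    refine back (fun φ => R (a, K, false) φ) 0 hr0 fun φ h => honly _ _ ?_
    simpa [State.next, hmax φ, other_ne] using h
  have r2 : ∀ j φ, R (a, K + j, false) φ := by
    intro j
    induction j with
    | zero => exact r1
    | succ j ih =>
      intro φ
      apply hboth
      have : θ φ a ≤ K + (j + 1) := (hmax φ).trans (by omega)
      simpa [State.next, this] using ih (φ + 1)
  -- With fewer than `K` holes, receptions by `a` alone either change nothing or add a hole, and at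
  -- `φ₀`, where the threshold is `K`, they add one.
  have r3 : ∀ j ≤ K, ∀ φ, R (a, K - j, false) φ := by
    intro j
    induction j with
    | zero => exact fun _ => r1
    | succ j ih =>
      intro hj
      have h1 : ∀ φ, R (a, K - (j + 1) + 1, false) φ := fun φ => by
        have := ih (by omega) φ
        rwa [show K - (j + 1) + 1 = K - j by omega]
      refine back (fun φ => R (a, K - (j + 1), false) φ) φ₀ ?_ ?_
      · apply honly
        have : ¬ θ φ₀ a ≤ K - (j + 1) := by omega
        simpa [State.next, this, other_ne] using h1 _
      · intro φ h
        apply honly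
        by_cases h2 : θ φ a ≤ K - (j + 1)
        · simpa [State.next, h2, other_ne] using h
        · simpa [State.next, h2, other_ne] using h1 _
  have r4 : ∀ g φ, R (a, g, false) φ := by
    intro g φ
    rcases le_total g K with h | h
    · have := r3 (K - g) (by omega) φ
      rwa [show K - (K - g) = g by omega] at this
    · have := r2 (g - K) φ
      rwa [show K + (g - K) = g by omega] at this
  have r5 : ∀ g φ, R (a, g, true) φ := by
    intro g φ
    apply honly
    simpa [State.next, other_ne] using r4 g _
  -- If the other user leads, receptions by `a` alone fill the holes until `a` takes over.
  have r6 : ∀ g φ, R (other a, g, true) φ := by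
    intro g
    induction g with
    | zero =>
      intro φ
      apply honly
      simpa [State.next, other_ne, other_other] using r4 _ _
    | succ g ih =>
      intro φ
      apply honly
      rcases g with _ | g
      · simpa [State.next, other_ne, other_other] using r4 _ _
      · simpa [State.next, other_ne, other_other] using ih _
  have r7 : ∀ g φ, R (other a, g, false) φ := by
    intro g
    induction g with
    | zero =>
      intro φ
      apply honly
      have : θ φ (other a) ≠ 0 := by have := hθ φ (other a); omega
      simpa [State.next, other_ne, other_other, this] using r4 _ _
    | succ g ih =>
      intro φ
      apply honly
      by_cases h : θ φ (other a) ≤ g + 1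
      · simpa [State.next, other_ne, other_other, h] using ih _
      · simpa [State.next, other_ne, other_other, h] using r6 _ _
  obtain ⟨b, g, v⟩ := s
  rcases eq_or_eq_other a b with rfl | rfl <;> rcases v with _ | _
  · exact r4 _ _
  · exact r5 _ _
  · exact r7 _ _
  · exact r6 _ _

/-- `ρ` has long-run average `c` per slot under the thresholds `θ`: the Poisson equation has a
bounded solution, on the states with at most `G` holes. -/
def HasPoisson (p : Fin 2 → ℝ) (G : ℕ) (ρ : (Fin 2 → ℕ) → State → (Fin 2 → Bool) → ℕ)
    (θ : ℕ → Fin 2 → ℕ) (c : ℝ) : Prop :=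
  ∃ (h : ℕ → State → ℝ) (H : ℝ), (∀ t s, s.2.1 ≤ G → |h t s| ≤ H) ∧
    ∀ t s, s.2.1 ≤ G →
      ∑ e, weight p e * (ρ (θ t) s e + h (t + 1) (s.next (θ t) e) - h t s - c) = 0

/-- The Poisson equation is solved on pairs of a state with at most `G` holes and a slot number
modulo `W`. The last clause yields a positive rate when the accessible state earns a reward upon
joint reception. -/
theorem hasPoisson_of_periodic {p : Fin 2 → ℝ} (hp : ∀ i, 0 < p i) (hp1 : ∀ i, p i ≤ 1)
    {b : Fin 2} (hb : p b < 1) {G : ℕ} (hG : 1 ≤ G) {W : ℕ} (hW : 1 ≤ W) {θ : ℕ → Fin 2 → ℕ}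
    (hθ : ∀ t i, 1 ≤ θ t i) (hθG : ∀ t i, θ t i ≤ G) (hper : ∀ t, θ (t % W) = θ t)
    (ρ : (Fin 2 → ℕ) → State → (Fin 2 → Bool) → ℕ) :
    ∃ c : ℝ, HasPoisson p G ρ θ c ∧
      ((∀ K : ℕ, ∀ η : Fin 2 → ℕ, η (other b) ≤ K →
        ρ η (other b, K, false) (fun _ => true) = 1) → 0 < c) := by
  have : NeZero W := ⟨by omega⟩
  set a := other b with ha
  have hb' : p (other a) < 1 := by rwa [ha, other_other]
  let θ' : ZMod W → Fin 2 → ℕ := fun φ => θ φ.val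
  have hθ' : ∀ t : ℕ, θ' (t : ZMod W) = θ t := fun t => by
    simp only [θ', ZMod.val_natCast]
    exact hper t
  obtain ⟨φ₀, -, hφ₀⟩ := Finset.exists_max_image Finset.univ (fun φ : ZMod W => θ' φ a)
    ⟨0, Finset.mem_univ _⟩
  have hmax : ∀ φ, θ' φ a ≤ θ' φ₀ a := fun φ => hφ₀ φ (Finset.mem_univ φ)
  let V : Set (State × ZMod W) := {z | z.1.2.1 ≤ G}
  have hV : V.Finite := by
    have : ((Set.univ ×ˢ (Set.Iic G ×ˢ Set.univ)) ×ˢ Set.univ : Set (State × ZMod W)).Finite :=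
      (Set.finite_univ.prod ((Set.finite_Iic G).prod Set.finite_univ)).prod Set.finite_univ
    refine this.subset fun z (hz : z.1.2.1 ≤ G) => ?_
    simpa using hz
  have hw : ∀ e, 0 ≤ weight p e := weight_nonneg fun i => ⟨(hp i).le, hp1 i⟩
  have hstep : ∀ z ∈ V, ∀ e, chainStep θ' z e ∈ V := fun z hz e =>
    State.next_card_le hG (fun i => hθG _ i) hz e
  have hz₀ : ((a, θ' φ₀ a, false), 0) ∈ V := hθG _ _
  have hreach := fun z (_ : z ∈ V) => chain_accessible hp hb' (θ := θ') (fun φ i => hθ _ i) hmax z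
  set f : State × ZMod W → ℝ := fun z => ∑ e, weight p e * (ρ (θ' z.2) z.1 e : ℝ) with hf
  obtain ⟨h, c, hc⟩ := exists_poisson hw (sum_weight p) hV hstep hz₀ hreach f
  refine ⟨c, ?_, ?_⟩
  · obtain ⟨H, hH⟩ := (hV.image fun z => |h z|).bddAbove
    refine ⟨fun t s => h (s, t), H, fun t s hs => hH ⟨(s, (t : ZMod W)), hs, rfl⟩,
      fun t s hs => ?_⟩
    have := hc (s, (t : ZMod W)) hs
    simp only [hf, chainStep, hθ'] at this
    simp only [mul_sub, mul_add, Finset.sum_sub_distrib, Finset.sum_add_distrib, ← Finset.sum_mul,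
      sum_weight, one_mul, Nat.cast_add, Nat.cast_one]
    linarith
  · intro hρ
    refine poisson_pos hw (sum_weight p) hV hstep hz₀ hreach (f := f) (fun z _ => ?_) ?_ hc
    · exact Finset.sum_nonneg fun e _ => mul_nonneg (hw e) (Nat.cast_nonneg _)
    · refine Finset.sum_pos' (fun e _ => mul_nonneg (hw e) (Nat.cast_nonneg _))
        ⟨fun _ => true, Finset.mem_univ _, ?_⟩
      rw [hρ _ _ (hmax 0)]
      simpa using weight_both_pos hp

end InOrderMulticast

/-! ### Independence of the slots and martingale estimates. -/

namespace InOrderMulticast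

variable {Ω : Type*} [MeasurableSpace Ω]

/-- A function of the channel outcomes that depends on the first `t` slots only. -/
def DependsBefore (t : ℕ) (f : (ℕ × Fin 2 → Bool) → ℝ) : Prop :=
  ∀ x y, (∀ a, a.1 < t → x a = y a) → f x = f y

section Channel

variable {μ : Measure Ω} {p : Fin 2 → ℝ} {E : ℕ × Fin 2 → Ω → Bool}

theorem IsErasureChannel.prob_mem [IsProbabilityMeasure μ] (hE : IsErasureChannel μ p E) (i : Fin 2) :
    0 ≤ p i ∧ p i ≤ 1 := by
  rw [← hE.prob 0 i]
  exact ⟨measureReal_nonneg, measureReal_le_one⟩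

theorem DependsBefore.factor {t : ℕ} {f : (ℕ × Fin 2 → Bool) → ℝ} (hf : DependsBefore t f) :
    ∃ g : (((Finset.range t ×ˢ Finset.univ : Finset (ℕ × Fin 2)) : Type) → Bool) → ℝ,
      ∀ x, f x = g fun a => x a := by
  -- The value `false` fills in the coordinates that `f` does not read.
  refine ⟨fun q => f fun a => if h : a ∈ (Finset.range t ×ˢ Finset.univ : Finset (ℕ × Fin 2))
    then q ⟨a, h⟩ else false, fun x => hf _ _ fun a ha => ?_⟩
  have : a ∈ (Finset.range t ×ˢ Finset.univ : Finset (ℕ × Fin 2)) := by simpa using ha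
  simp [this]

theorem IsErasureChannel.measurable_of_dependsBefore (hE : IsErasureChannel μ p E) {t : ℕ}
    {f : (ℕ × Fin 2 → Bool) → ℝ} (hf : DependsBefore t f) :
    Measurable fun ω => f fun a => E a ω := by
  obtain ⟨g, hg⟩ := hf.factor
  simp only [hg]
  exact (Measurable.of_discrete (f := g)).comp (measurable_pi_lambda _ fun a => hE.measurable a)

variable [IsProbabilityMeasure μ]

theorem IsErasureChannel.integrable_of_dependsBefore (hE : IsErasureChannel μ p E) {t : ℕ}
    {f : (ℕ × Fin 2 → Bool) → ℝ} (hf : DependsBefore t f) :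
    Integrable (fun ω => f fun a => E a ω) μ := by
  obtain ⟨g, hg⟩ := hf.factor
  obtain ⟨C, hC⟩ := (Set.finite_range fun q => ‖g q‖).bddAbove
  refine Integrable.of_bound (hE.measurable_of_dependsBefore hf).aestronglyMeasurable C
    (ae_of_all _ fun ω => ?_)
  rw [hg]
  exact hC ⟨_, rfl⟩

theorem IsErasureChannel.measureReal_slot (hE : IsErasureChannel μ p E) (t : ℕ)
    (e : Fin 2 → Bool) : μ.real {ω | (fun i => E (t, i) ω) = e} = weight p e := by
  have hslot : iIndepFun (fun i : Fin 2 => E (t, i)) μ :=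
    hE.indep.precomp (g := fun i : Fin 2 => (t, i)) fun i j h => (Prod.mk.inj h).2
  have h1 := hslot.measure_inter_preimage_eq_mul Finset.univ (sets := fun i => {e i})
    (fun i _ => measurableSet_singleton _)
  have h2 : {ω | (fun i => E (t, i) ω) = e} = ⋂ i ∈ Finset.univ, E (t, i) ⁻¹' {e i} := by
    ext ω
    simp [funext_iff]
  rw [h2, measureReal_def, h1, ENNReal.toReal_prod]
  unfold weight
  refine Finset.prod_congr rfl fun i _ => ?_
  rw [← measureReal_def]
  have hm : MeasurableSet {ω | E (t, i) ω = true} := hE.measurable (t, i) (measurableSet_singleton _)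
  split_ifs with h
  · rw [h, ← hE.prob t i]
    rfl
  · rw [← hE.prob t i, ← probReal_compl_eq_one_sub hm]
    congr 1
    ext ω
    simp [Bool.eq_false_iff.mpr h]

/-- Averaging over the outcome of a slot, given the outcomes of the previous slots. -/
theorem IsErasureChannel.integral_slot (hE : IsErasureChannel μ p E) {t : ℕ}
    {Φ : (ℕ × Fin 2 → Bool) → (Fin 2 → Bool) → ℝ} (hΦ : ∀ e, DependsBefore t fun x => Φ x e) :
    ∫ ω, Φ (fun a => E a ω) (fun i => E (t, i) ω) ∂μ =
      ∫ ω, ∑ e, weight p e * Φ (fun a => E a ω) e ∂μ := by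
  have hind : ∀ e, DependsBefore (t + 1) fun x => if (fun i => x (t, i)) = e then (1 : ℝ) else 0 :=
    fun e x y h => by
      have : (fun i => x (t, i)) = fun i => y (t, i) := funext fun i => h _ (Nat.lt_succ_self t)
      simp only [this]
  have hprod : ∀ e, DependsBefore (t + 1) fun x =>
      Φ x e * if (fun i => x (t, i)) = e then (1 : ℝ) else 0 := fun e x y h => by
    have h1 := hΦ e x y fun a ha => h a (by omega)
    have h2 := hind e x y h
    simp only at h1 h2
    simp only [h1, h2]
  have h1 : ∀ ω, Φ (fun a => E a ω) (fun i => E (t, i) ω) = ∑ e, Φ (fun a => E a ω) e *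
      if (fun i => E (t, i) ω) = e then (1 : ℝ) else 0 := fun ω => by simp
  simp only [h1]
  rw [integral_finsetSum _ fun e _ => hE.integrable_of_dependsBefore (hprod e),
    integral_finsetSum _ fun e _ => (hE.integrable_of_dependsBefore (hΦ e)).const_mul _]
  refine Finset.sum_congr rfl fun e _ => ?_
  have hindep : IndepFun (fun ω => Φ (fun a => E a ω) e)
      (fun ω => if (fun i => E (t, i) ω) = e then (1 : ℝ) else 0) μ := by
    obtain ⟨g, hg⟩ := (hΦ e).factor
    have h2 := hE.indep.indepFun_finset (Finset.range t ×ˢ Finset.univ) ({t} ×ˢ Finset.univ)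
      (by
        rw [Finset.disjoint_left]
        intro a ha hb
        simp only [Finset.mem_product, Finset.mem_range, Finset.mem_singleton, Finset.mem_univ,
          and_true] at ha hb
        omega) hE.measurable
    have h3 := h2.comp (φ := g) (ψ := fun q => if (fun i => q ⟨(t, i), by simp⟩) = e then (1 : ℝ)
      else 0) Measurable.of_discrete Measurable.of_discrete
    convert h3 using 1
    · funext ω
      exact hg _
    · funext ω
      rfl
  rw [hindep.integral_fun_mul_eq_mul_integral
    (hE.measurable_of_dependsBefore (hΦ e)).aestronglyMeasurable
    (hE.measurable_of_dependsBefore (hind e)).aestronglyMeasurable, integral_const_mul,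
    ← hE.measureReal_slot t e, mul_comm]
  congr 1
  have hm : MeasurableSet {ω | (fun i => E (t, i) ω) = e} :=
    (measurable_pi_lambda _ fun i => hE.measurable (t, i)) (measurableSet_singleton e)
  rw [← integral_indicator_one hm]
  refine integral_congr_ae (ae_of_all _ fun ω => ?_)
  simp [Set.indicator_apply]

theorem State.run_congr (θ : ℕ → Fin 2 → ℕ) {n : ℕ} {x y : ℕ × Fin 2 → Bool}
    (h : ∀ a, a.1 < n → x a = y a) : State.run θ x n = State.run θ y n := by
  induction n with
  | zero => rfl
  | succ n ih =>
    unfold State.run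
    rw [ih fun a ha => h a (by omega)]
    congr 1
    funext i
    exact h _ (Nat.lt_succ_self n)

variable {G : ℕ} {θ : ℕ → Fin 2 → ℕ}

/-- Orthogonality of a martingale increment to the past: given the earlier slots, `Δ` has mean zero.
-/
theorem IsErasureChannel.integral_run (hE : IsErasureChannel μ p E) (hG : 1 ≤ G)
    (hθG : ∀ t i, θ t i ≤ G) (t : ℕ) {Δ : State → (Fin 2 → Bool) → ℝ}
    (hΔ : ∀ s, s.2.1 ≤ G → ∑ e, weight p e * Δ s e = 0)
    {f : (ℕ × Fin 2 → Bool) → ℝ} (hf : DependsBefore t f) :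
    ∫ ω, f (fun a => E a ω) * Δ (State.run θ (fun a => E a ω) t) (fun i => E (t, i) ω) ∂μ = 0 := by
  have h1 := hE.integral_slot (t := t) (Φ := fun x e => f x * Δ (State.run θ x t) e)
    fun e x y h => by
      have h1 := hf x y h
      have h2 := State.run_congr θ h
      simp only [h1, h2]
  rw [h1]
  have h2 : ∀ ω, ∑ e, weight p e *
      (f (fun a => E a ω) * Δ (State.run θ (fun a => E a ω) t) e) = 0 := fun ω => by
    have := hΔ _ (State.run_card_le hG hθG (fun a => E a ω) t)
    rw [← mul_zero (f fun a => E a ω), ← this, Finset.mul_sum]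
    exact Finset.sum_congr rfl fun e _ => by ring
  simp [h2]

theorem dependsBefore_slot (θ : ℕ → Fin 2 → ℕ) (t : ℕ) (Δ : State → (Fin 2 → Bool) → ℝ) :
    DependsBefore (t + 1) fun x => Δ (State.run θ x t) (fun i => x (t, i)) := fun x y h => by
  have h1 : (fun i => x (t, i)) = fun i => y (t, i) := funext fun i => h _ (Nat.lt_succ_self t)
  have h2 := State.run_congr θ (n := t) (x := x) (y := y) fun a ha => h a (by omega)
  simp only [h1, h2]

theorem dependsBefore_sum (θ : ℕ → Fin 2 → ℕ) (n : ℕ) (Δ : ℕ → State → (Fin 2 → Bool) → ℝ) :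
    DependsBefore n fun x => ∑ t ∈ Finset.range n, Δ t (State.run θ x t) (fun i => x (t, i)) :=
  fun x y h => Finset.sum_congr rfl fun t ht => dependsBefore_slot θ t (Δ t) x y fun a ha =>
    h a (by have := Finset.mem_range.mp ht; omega)

/-- Second moment of a martingale with bounded increments. -/
theorem IsErasureChannel.integral_sq_sum_le (hE : IsErasureChannel μ p E) (hG : 1 ≤ G)
    (hθG : ∀ t i, θ t i ≤ G) {Δ : ℕ → State → (Fin 2 → Bool) → ℝ} {C : ℝ}
    (hC : ∀ t s e, s.2.1 ≤ G → |Δ t s e| ≤ C)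
    (hΔ : ∀ t s, s.2.1 ≤ G → ∑ e, weight p e * Δ t s e = 0) (n : ℕ) :
    ∫ ω, (∑ t ∈ Finset.range n, Δ t (State.run θ (fun a => E a ω) t) (fun i => E (t, i) ω)) ^ 2 ∂μ
      ≤ n * C ^ 2 := by
  induction n with
  | zero => simp
  | succ n ih =>
    have hM := dependsBefore_sum θ n Δ
    have hD := dependsBefore_slot θ n (Δ n)
    have i1 : Integrable (fun ω => (∑ t ∈ Finset.range n,
        Δ t (State.run θ (fun a => E a ω) t) (fun i => E (t, i) ω)) ^ 2) μ :=
      hE.integrable_of_dependsBefore (t := n) (f := fun x => (∑ t ∈ Finset.range n,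
        Δ t (State.run θ x t) (fun i => x (t, i))) ^ 2) fun x y h => by
          have := hM x y h
          simp only at this ⊢
          rw [this]
    have i2 : Integrable (fun ω => (∑ t ∈ Finset.range n,
        Δ t (State.run θ (fun a => E a ω) t) (fun i => E (t, i) ω)) *
        Δ n (State.run θ (fun a => E a ω) n) (fun i => E (n, i) ω)) μ :=
      hE.integrable_of_dependsBefore (t := n + 1) (f := fun x => (∑ t ∈ Finset.range n,
        Δ t (State.run θ x t) (fun i => x (t, i))) *
        Δ n (State.run θ x n) (fun i => x (n, i))) fun x y h => by
          have h1 := hM x y fun a ha => h a (by omega)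
          have h2 := hD x y h
          simp only at h1 h2 ⊢
          rw [h1, h2]
    have i3 : Integrable (fun ω => (Δ n (State.run θ (fun a => E a ω) n)
        (fun i => E (n, i) ω)) ^ 2) μ :=
      hE.integrable_of_dependsBefore (t := n + 1) (f := fun x =>
        (Δ n (State.run θ x n) (fun i => x (n, i))) ^ 2) fun x y h => by
          have h2 := hD x y h
          simp only at h2 ⊢
          rw [h2]
    have h3 : ∫ ω, (Δ n (State.run θ (fun a => E a ω) n) (fun i => E (n, i) ω)) ^ 2 ∂μ ≤ C ^ 2 := by
      calc _ ≤ ∫ _, C ^ 2 ∂μ := integral_mono i3 (integrable_const _) fun ω =>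
            sq_le_sq' (abs_le.mp (hC n _ _ (State.run_card_le hG hθG _ n))).1
              (abs_le.mp (hC n _ _ (State.run_card_le hG hθG _ n))).2
        _ = C ^ 2 := by simp
    simp only [Finset.sum_range_succ, add_sq, mul_assoc]
    have i12 : Integrable (fun ω => (∑ t ∈ Finset.range n,
        Δ t (State.run θ (fun a => E a ω) t) (fun i => E (t, i) ω)) ^ 2 + 2 *
        ((∑ t ∈ Finset.range n, Δ t (State.run θ (fun a => E a ω) t) (fun i => E (t, i) ω)) *
        Δ n (State.run θ (fun a => E a ω) n) (fun i => E (n, i) ω))) μ := i1.add (i2.const_mul 2)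
    -- The cross term vanishes by orthogonality.
    rw [integral_add i12 i3, integral_add i1 (i2.const_mul 2),
      integral_const_mul, hE.integral_run hG hθG n (hΔ n) hM]
    push_cast
    linarith

/-- Sum of the rewards `ρ` over the first `n` slots. -/
def total (ρ : (Fin 2 → ℕ) → State → (Fin 2 → Bool) → ℕ) (θ : ℕ → Fin 2 → ℕ)
    (x : ℕ × Fin 2 → Bool) (n : ℕ) : ℕ :=
  ∑ t ∈ Finset.range n, ρ (θ t) (State.run θ x t) (fun i => x (t, i))

/-- The Poisson equation says that the `Δ` below are martingale increments. Their sum differs from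
`total - n * c` by at most `2 * H`, and Chebyshev's inequality applies to it. -/
theorem HasPoisson.tail {ρ : (Fin 2 → ℕ) → State → (Fin 2 → Bool) → ℕ} (hρ : ∀ η s e, ρ η s e ≤ 1)
    {c : ℝ} (hc : HasPoisson p G ρ θ c) (hE : IsErasureChannel μ p E) (hG : 1 ≤ G)
    (hθG : ∀ t i, θ t i ≤ G) :
    ∃ B : ℝ, 0 ≤ B ∧ ∀ (n : ℕ) (x : ℝ), 0 < x →
      μ.real {ω | x + B ≤ |(total ρ θ (fun a => E a ω) n : ℝ) - n * c|} ≤ n * B / x ^ 2 := by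
  obtain ⟨h, H, hH, hh⟩ := hc
  have hH0 : 0 ≤ H := (abs_nonneg _).trans (hH 0 (0, 0, false) (Nat.zero_le G))
  set Δ : ℕ → State → (Fin 2 → Bool) → ℝ := fun t s e =>
    ρ (θ t) s e + h (t + 1) (s.next (θ t) e) - h t s - c with hΔ
  set C := 1 + 2 * H + |c| with hCdef
  have hC : ∀ t s e, s.2.1 ≤ G → |Δ t s e| ≤ C := by
    intro t s e hs
    have h1 := abs_le.mp (hH t s hs)
    have h2 := abs_le.mp (hH (t + 1) _ (State.next_card_le hG (hθG t) hs e))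
    have h3 : (ρ (θ t) s e : ℝ) ≤ 1 := by exact_mod_cast hρ (θ t) s e
    have h4 : (0 : ℝ) ≤ ρ (θ t) s e := Nat.cast_nonneg _
    have h5 := abs_le.mp (le_refl |c|)
    rw [abs_le]
    constructor <;> simp only [hΔ, hCdef] <;> linarith
  have hsum : ∀ x n, ∑ t ∈ Finset.range n, Δ t (State.run θ x t) (fun i => x (t, i)) =
      (total ρ θ x n : ℝ) - n * c + (h n (State.run θ x n) - h 0 (State.run θ x 0)) := by
    intro x n
    induction n with
    | zero => simp [total]
    | succ n ih =>
      rw [Finset.sum_range_succ, ih]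
      unfold total
      rw [Finset.sum_range_succ]
      simp only [hΔ]
      rw [show State.run θ x (n + 1) = (State.run θ x n).next (θ n) (fun i => x (n, i)) from rfl]
      push_cast
      ring
  have hC0 : 0 ≤ C := by positivity
  -- One constant covers both the boundary terms `2 * H` and the variance `C ^ 2` per slot.
  refine ⟨2 * H + C ^ 2, by positivity, fun n x hx => ?_⟩
  have h1 := hE.integral_sq_sum_le hG hθG hC hh n
  set M : Ω → ℝ := fun ω => ∑ t ∈ Finset.range n,
    Δ t (State.run θ (fun a => E a ω) t) (fun i => E (t, i) ω) with hM
  have hint : Integrable (fun ω => M ω ^ 2) μ :=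
    hE.integrable_of_dependsBefore (t := n) (f := fun x => (∑ t ∈ Finset.range n,
      Δ t (State.run θ x t) (fun i => x (t, i))) ^ 2) fun x y h => by
        have := dependsBefore_sum θ n Δ x y h
        simp only at this ⊢
        rw [this]
  have h2 := mul_meas_ge_le_integral_of_nonneg (ae_of_all μ fun ω => sq_nonneg (M ω)) hint (x ^ 2)
  have h3 : {ω | x + (2 * H + C ^ 2) ≤ |(total ρ θ (fun a => E a ω) n : ℝ) - n * c|} ⊆
      {ω | x ^ 2 ≤ M ω ^ 2} := by
    intro ω hω
    simp only [Set.mem_ofPred_eq] at hω ⊢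
    have h4 := hsum (fun a => E a ω) n
    have h5 := abs_le.mp (hH n _ (State.run_card_le hG hθG (fun a => E a ω) n))
    have h6 := abs_le.mp (hH 0 _ (State.run_card_le hG hθG (fun a => E a ω) 0))
    rw [← sq_abs (M ω)]
    refine pow_le_pow_left₀ hx.le ?_ 2
    have h7 : M ω = _ := h4
    have h8 := sq_nonneg C
    rcases le_abs'.mp hω with h | h
    · rw [le_abs]; right; linarith
    · rw [le_abs]; left; linarith
  rw [le_div_iff₀ (by positivity), mul_comm]
  have h4 : (n : ℝ) * C ^ 2 ≤ n * (2 * H + C ^ 2) :=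
    mul_le_mul_of_nonneg_left (by linarith) (Nat.cast_nonneg n)
  calc _ ≤ x ^ 2 * μ.real {ω | x ^ 2 ≤ M ω ^ 2} :=
        mul_le_mul_of_nonneg_left (measureReal_mono h3) (sq_nonneg x)
    _ ≤ _ := h2.trans (h1.trans h4)

end Channel
end InOrderMulticast

/-! ### Convergence in probability of throughput and smoothness. -/

namespace InOrderMulticast

variable {Ω : Type*} [MeasurableSpace Ω] {μ : Measure Ω} [IsProbabilityMeasure μ] {p : Fin 2 → ℝ}
  {E : ℕ × Fin 2 → Ω → Bool} {G : ℕ} {θ : ℕ → Fin 2 → ℕ}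

theorem leadGain_le_one (η : Fin 2 → ℕ) (s : State) (e : Fin 2 → Bool) : leadGain η s e ≤ 1 := by
  unfold leadGain
  split_ifs <;> omega

theorem lagGain_le_one (η : Fin 2 → ℕ) (s : State) (e : Fin 2 → Bool) : lagGain η s e ≤ 1 := by
  unfold lagGain
  split_ifs <;> omega

theorem gain_le_one (i : Fin 2) (η : Fin 2 → ℕ) (s : State) (e : Fin 2 → Bool) :
    gain i η s e ≤ 1 := by
  unfold gain
  split_ifs
  · exact leadGain_le_one η s e
  · exact lagGain_le_one η s e

theorem frontGain_le_one (η : Fin 2 → ℕ) (s : State) (e : Fin 2 → Bool) :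
    frontGain η s e ≤ 1 := by
  unfold frontGain
  split_ifs <;> omega

theorem tendsto_mul_div_sq (B y : ℝ) :
    Tendsto (fun n : ℕ => n * B / (y * n) ^ 2) atTop (𝓝 0) := by
  have h : ∀ n : ℕ, n * B / (y * n) ^ 2 = B / y ^ 2 * (1 / (n : ℝ)) := by
    intro n
    rcases eq_or_ne (n : ℝ) 0 with h0 | h0
    · simp [h0]
    · rcases eq_or_ne y 0 with rfl | hy
      · simp
      · field_simp
  simp only [h]
  simpa using (tendsto_one_div_atTop_nhds_zero_nat (𝕜 := ℝ)).const_mul (B / y ^ 2)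

theorem tendstoInMeasure_of_bound {f : ℕ → Ω → ℝ} {c : ℝ}
    (h : ∀ ε > 0, ∃ b : ℕ → ℝ, Tendsto b atTop (𝓝 0) ∧
      ∀ᶠ n in atTop, μ.real {ω | ε ≤ |f n ω - c|} ≤ b n) :
    TendstoInMeasure μ f atTop fun _ => c := by
  rw [tendstoInMeasure_iff_measureReal_norm]
  intro ε hε
  obtain ⟨b, hb, hb'⟩ := h ε hε
  exact tendsto_of_tendsto_of_tendsto_of_le_of_le' tendsto_const_nhds hb
    (Eventually.of_forall fun _ => measureReal_nonneg) hb'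

theorem abs_div_sub_le_iff {a ε c : ℝ} {n : ℕ} (hn : 0 < n) :
    ε ≤ |a / n - c| ↔ ε * n ≤ |a - n * c| := by
  have hn' : (0 : ℝ) < n := by exact_mod_cast hn
  have : a - n * c = (a / n - c) * n := by field_simp
  rw [this, abs_mul, abs_of_pos hn', mul_le_mul_iff_of_pos_right hn']

theorem HasPoisson.tendstoInMeasure {ρ : (Fin 2 → ℕ) → State → (Fin 2 → Bool) → ℕ}
    (hρ : ∀ η s e, ρ η s e ≤ 1) {c : ℝ} (hc : HasPoisson p G ρ θ c) (hE : IsErasureChannel μ p E)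
    (hG : 1 ≤ G) (hθG : ∀ t i, θ t i ≤ G) :
    TendstoInMeasure μ (fun (n : ℕ) ω => (total ρ θ (fun a => E a ω) n : ℝ) / n) atTop
      fun _ => c := by
  obtain ⟨B, hB, h⟩ := hc.tail hρ hE hG hθG
  refine tendstoInMeasure_of_bound fun ε hε => ⟨_, tendsto_mul_div_sq B (ε / 2), ?_⟩
  filter_upwards [eventually_gt_atTop 0, eventually_ge_atTop ⌈2 * B / ε⌉₊] with n h0 hn
  have hn' : 2 * B / ε ≤ n := (Nat.le_ceil _).trans (by exact_mod_cast hn)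
  rw [div_le_iff₀ hε] at hn'
  have h0' : (0 : ℝ) < n := by exact_mod_cast h0
  refine le_trans (measureReal_mono fun ω hω => ?_) (h n (ε / 2 * n) (by positivity))
  simp only [Set.mem_ofPred_eq] at hω ⊢
  rw [abs_div_sub_le_iff h0] at hω
  linarith

theorem hasSmoothness_of_hasPoisson {i : Fin 2} {c : ℝ} (hc : HasPoisson p G (gain i) θ c)
    (hE : IsErasureChannel μ p E) (hG : 1 ≤ G) (hθ : ∀ t i, 1 ≤ θ t i) (hθG : ∀ t i, θ t i ≤ G) :
    HasSmoothness μ E (fun t => multicast (θ t 0) (θ t 1)) i c := by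
  unfold HasSmoothness
  convert hc.tendstoInMeasure (gain_le_one i) hE hG hθG using 4 with n ω
  unfold total
  push_cast
  refine Finset.sum_congr rfl fun t _ => ?_
  simp only [Config.requiredAfter_lt_succ_iff hθ]
  have := gain_le_one i (θ t) (State.run θ (fun a => E a ω) t) fun i => E (t, i) ω
  split_ifs with h
  · rw [h, Nat.cast_one]
  · rw [show gain i (θ t) (State.run θ (fun a => E a ω) t) (fun i => E (t, i) ω) = 0 by omega,
      Nat.cast_zero]

theorem total_add_sub_le {ρ : (Fin 2 → ℕ) → State → (Fin 2 → Bool) → ℕ}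
    (hρ : ∀ η s e, ρ η s e ≤ 1) (x : ℕ × Fin 2 → Bool) (k d : ℕ) :
    total ρ θ x (k + d) ≤ total ρ θ x k + d := by
  induction d with
  | zero => exact le_rfl
  | succ d ih =>
    have := hρ (θ (k + d)) (State.run θ x (k + d)) fun i => x (k + d, i)
    have h : total ρ θ x (k + (d + 1)) = total ρ θ x (k + d) + _ :=
      Finset.sum_range_succ _ (k + d)
    omega

/-- Let `k = n - d` with `d` about `ε n / 4`. Either `low` at time `n` has passed `front` at time
`k`, which is at most `d` below `front` at time `n`, or the last `d` slots brought at most `G` lag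
gains instead of about `c * d`. The second case is improbable, as `c > 0`. -/
theorem hasThroughput_of_hasPoisson (i : Fin 2) {τ c : ℝ} (hτ : HasPoisson p G frontGain θ τ)
    (hc : HasPoisson p G lagGain θ c) (hc0 : 0 < c) (hE : IsErasureChannel μ p E) (hG : 1 ≤ G)
    (hθ : ∀ t i, 1 ≤ θ t i) (hθG : ∀ t i, θ t i ≤ G) :
    HasThroughput μ E (fun t => multicast (θ t 0) (θ t 1)) i τ := by
  obtain ⟨B₁, hB₁, h₁⟩ := hτ.tail frontGain_le_one hE hG hθG
  obtain ⟨B₂, hB₂, h₂⟩ := hc.tail lagGain_le_one hE hG hθG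
  refine tendstoInMeasure_of_bound fun ε' hε' => ?_
  -- Capping `ε` at `1` ensures `d ≤ n`.
  obtain ⟨ε, hε, hε1, hεε'⟩ : ∃ ε : ℝ, 0 < ε ∧ ε ≤ 1 ∧ ε ≤ ε' :=
    ⟨min ε' 1, lt_min hε' one_pos, min_le_right _ _, min_le_left _ _⟩
  -- The lag totals at `n` and `k` may each deviate by `c * ε / 16 * n + B₂`. Together this uses
  -- half of `c * ε / 4 * n`, the approximate lag gain over `d` slots; the other half absorbs `c + G
  -- + 2 * B₂` for large `n`.
  refine ⟨fun n : ℕ => n * B₁ / (ε / 4 * n) ^ 2 + (n * B₂ / (c * ε / 16 * n) ^ 2 +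
    n * B₂ / (c * ε / 16 * n) ^ 2), ?_, ?_⟩
  · simpa using (tendsto_mul_div_sq B₁ (ε / 4)).add
      ((tendsto_mul_div_sq B₂ (c * ε / 16)).add (tendsto_mul_div_sq B₂ (c * ε / 16)))
  filter_upwards [eventually_gt_atTop 0, eventually_ge_atTop ⌈(4 * B₁ + 4) / ε⌉₊,
    eventually_ge_atTop ⌈(c + G + 2 * B₂) * 8 / (c * ε)⌉₊] with n h0 hn1 hn2
  have hcε : 0 < c * ε := mul_pos hc0 hε
  have hn1' : (4 * B₁ + 4) / ε ≤ n := (Nat.le_ceil _).trans (by exact_mod_cast hn1)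
  have hn2' : (c + G + 2 * B₂) * 8 / (c * ε) ≤ n := (Nat.le_ceil _).trans (by exact_mod_cast hn2)
  rw [div_le_iff₀ hε] at hn1'
  rw [div_le_iff₀ hcε] at hn2'
  have h0' : (0 : ℝ) < n := by exact_mod_cast h0
  set d := ⌊ε / 4 * n⌋₊ with hd
  have hdle : (d : ℝ) ≤ ε / 4 * n := Nat.floor_le (by positivity)
  have hdge : ε / 4 * n - 1 < d := Nat.sub_one_lt_floor _
  have hdn : d ≤ n := by
    have : (d : ℝ) ≤ n := by nlinarith
    exact_mod_cast this
  obtain ⟨k, hk⟩ : ∃ k, n = k + d := ⟨n - d, by omega⟩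
  have hkd : (n : ℝ) = k + d := by exact_mod_cast hk
  have hkn : (k : ℝ) ≤ n := by exact_mod_cast (by omega : k ≤ n)
  have hx : 0 < c * ε / 16 * n := by positivity
  have hsub : {ω | ε' ≤ |(requiredAfter (fun t => multicast (θ t 0) (θ t 1))
        (fun a => E a ω) i n : ℝ) / n - τ|} ⊆
      {ω | ε / 4 * n + B₁ ≤ |(total frontGain θ (fun a => E a ω) n : ℝ) - n * τ|} ∪
      ({ω | c * ε / 16 * n + B₂ ≤ |(total lagGain θ (fun a => E a ω) n : ℝ) - n * c|} ∪
      {ω | c * ε / 16 * n + B₂ ≤ |(total lagGain θ (fun a => E a ω) k : ℝ) - k * c|}) := by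
    intro ω hω
    by_contra hcon
    simp only [Set.mem_union, Set.mem_ofPred_eq, not_or, not_le, abs_lt] at hω hcon
    have hω' := hεε'.trans hω
    rw [abs_div_sub_le_iff h0] at hω'
    obtain ⟨⟨a1, a2⟩, ⟨b1, b2⟩, ⟨c1, c2⟩⟩ := hcon
    have f1 := Config.requiredAfter_le_front hθ (fun a => E a ω) i n
    have f2 := Config.low_le_requiredAfter hθ (fun a => E a ω) i n
    have f3 := Config.run_front hθ (fun a => E a ω) n
    have f4 := Config.run_front hθ (fun a => E a ω) k
    have f5 := total_add_sub_le (θ := θ) frontGain_le_one (fun a => E a ω) k d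
    rw [← hk] at f5
    change _ = 1 + total frontGain θ (fun a => E a ω) n at f3
    change _ = 1 + total frontGain θ (fun a => E a ω) k at f4
    rcases Config.front_le_low_or_sum_lagGain_le hG hθ hθG (fun a => E a ω) k d with h | h
    · rw [← hk] at h
      have g1 : (requiredAfter (fun t => multicast (θ t 0) (θ t 1)) (fun a => E a ω) i n : ℝ) ≤
          1 + total frontGain θ (fun a => E a ω) n := by exact_mod_cast (by omega)
      have g2 : 1 + (total frontGain θ (fun a => E a ω) n : ℝ) ≤
          (requiredAfter (fun t => multicast (θ t 0) (θ t 1)) (fun a => E a ω) i n : ℝ) + d := by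
        exact_mod_cast (by omega)
      rcases le_abs'.mp hω' with h | h <;> linarith
    · have g0 := Finset.sum_range_add_sum_Ico (fun t => lagGain (θ t)
        (State.run θ (fun a => E a ω) t) fun i => E (t, i) ω) (Nat.le_add_right k d)
      change total lagGain θ (fun a => E a ω) k + _ = total lagGain θ (fun a => E a ω) (k + d) at g0
      rw [← hk] at g0 h
      have g1 : total lagGain θ (fun a => E a ω) n ≤ total lagGain θ (fun a => E a ω) k + G := by
        omega
      have g2 : (total lagGain θ (fun a => E a ω) n : ℝ) ≤
          total lagGain θ (fun a => E a ω) k + G := by exact_mod_cast g1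
      have g3 : c * (ε / 4 * n - 1) ≤ c * d := mul_le_mul_of_nonneg_left hdge.le hc0.le
      have g4 : (n : ℝ) * c = k * c + c * d := by
        rw [hkd]
        ring
      linarith
  refine (measureReal_mono hsub).trans ((measureReal_union_le _ _).trans (add_le_add
    (h₁ n _ (by positivity)) ((measureReal_union_le _ _).trans (add_le_add (h₂ n _ hx)
    ((h₂ k _ hx).trans ?_)))))
  gcongr

/-- If some user never receives anything, the indices of the required packets stay bounded. -/
theorem requiredAfter_le_of_never (hG : 1 ≤ G) (hθ : ∀ t i, 1 ≤ θ t i) (hθG : ∀ t i, θ t i ≤ G)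
    {x : ℕ × Fin 2 → Bool} {b : Fin 2} (hx : ∀ t, x (t, b) = false) (i : Fin 2) (n : ℕ) :
    requiredAfter (fun t => multicast (θ t 0) (θ t 1)) x i n ≤ G + 1 := by
  refine (Config.requiredAfter_le_front hθ x i n).trans ?_
  have hD : (Config.run θ x n).decoded b = ∅ := by
    rw [← Config.run_decoded hθ]
    induction n with
    | zero => rfl
    | succ n ih =>
      unfold decodedAfter
      rw [if_neg (by simp [hx]), ih]
  have hcard := State.run_card_le hG hθG x n
  rw [← Config.run_state hθ] at hcard
  have hv := Config.run_valid θ x n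
  -- User `b` has decoded nothing: as leader it forces `front ≤ 1`, otherwise every packet below
  -- `front` is a hole.
  rcases eq_or_eq_other (Config.run θ x n).lead b with h | h
  · rw [h, Config.decoded_lead, Finset.Ico_eq_empty_iff] at hD
    omega
  · rw [h, Config.decoded_lag, Finset.union_eq_empty, Finset.sdiff_eq_empty_iff_subset] at hD
    have := Finset.card_le_card hD.1
    rw [Nat.card_Ico] at this
    have h2 : (Config.run θ x n).holes.card ≤ G := hcard
    omega

theorem requiredAfter_of_always (hθ : ∀ t i, 1 ≤ θ t i) {x : ℕ × Fin 2 → Bool}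
    (hx : ∀ t i, x (t, i) = true) (i : Fin 2) (n : ℕ) :
    requiredAfter (fun t => multicast (θ t 0) (θ t 1)) x i n = n + 1 := by
  have h : Config.run θ x n = ⟨0, n + 1, ∅, false⟩ := by
    induction n with
    | zero => rfl
    | succ n ih =>
      unfold Config.run
      have := hθ n 0
      have h0 : θ n 0 ≠ 0 := by omega
      rw [ih]
      simp [Config.next, hx, h0]
  have h1 := Config.requiredAfter_le_front hθ x i n
  have h2 := Config.low_le_requiredAfter hθ x i n
  rw [h] at h1 h2
  rw [Config.low_of_empty rfl] at h2
  exact le_antisymm h1 h2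

theorem sum_increase_le (r : ℕ → ℕ) (hr : Monotone r) (n : ℕ) :
    (∑ k ∈ Finset.range n, if r k < r (k + 1) then (1 : ℝ) else 0) ≤ r n := by
  induction n with
  | zero => simp
  | succ n ih =>
    rw [Finset.sum_range_succ]
    have h1 : r n ≤ r (n + 1) := hr (Nat.le_succ n)
    split_ifs with h
    · have : (r n : ℝ) + 1 ≤ r (n + 1) := by exact_mod_cast h
      linarith
    · have : (r n : ℝ) ≤ r (n + 1) := by exact_mod_cast h1
      linarith

theorem requiredAfter_mono (code : ℕ → Decoded → Finset ℕ) (x : ℕ × Fin 2 → Bool) (i : Fin 2) :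
    Monotone (requiredAfter code x i) := by
  refine monotone_nat_of_le_succ fun n => ?_
  have hsub : decodedAfter code x n i ⊆ decodedAfter code x (n + 1) i := by
    rw [decodedAfter]
    beta_reduce
    split_ifs
    · unfold decode
      split_ifs
      · exact Finset.subset_union_left
      · exact subset_rfl
    · exact subset_rfl
  exact Nat.find_min' _ ⟨one_le_required _, fun h => required_notMem _ (hsub h)⟩

theorem tendstoInMeasure_of_ae_abs_le {f : ℕ → Ω → ℝ} {c K : ℝ}
    (h : ∀ᵐ ω ∂μ, ∀ n : ℕ, |f n ω - n * c| ≤ K) :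
    TendstoInMeasure μ (fun (n : ℕ) ω => f n ω / n) atTop fun _ => c := by
  refine tendstoInMeasure_of_bound fun ε hε => ⟨fun _ => 0, tendsto_const_nhds, ?_⟩
  filter_upwards [eventually_gt_atTop 0, eventually_gt_atTop ⌈K / ε⌉₊] with n h0 hn
  have hn' : K / ε < n := (Nat.le_ceil _).trans_lt (by exact_mod_cast hn)
  rw [div_lt_iff₀ hε] at hn'
  refine le_of_eq ?_
  rw [measureReal_def, ENNReal.toReal_eq_zero_iff]
  left
  refine measure_mono_null (fun ω hω => ?_) (ae_iff.mp h)
  simp only [Set.mem_ofPred_eq] at hω ⊢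
  rw [abs_div_sub_le_iff h0] at hω
  intro h1
  have := h1 n
  linarith

end InOrderMulticast

/-! ### Time-sharing: blocks, windows and the limit. -/

namespace InOrderMulticast

section TimeSharing

variable {R W : ℕ} {x : Fin R → ℝ} {s : ℕ → Fin R}

theorem block_le {len : Fin R → ℕ} (hlen : ∀ t, ∑ q ∈ Finset.Iio (s t), len q ≤ t % W ∧
    t % W < ∑ q ∈ Finset.Iic (s t), len q) {r : Fin R} {t t' : ℕ}
    (h1 : ∑ q ∈ Finset.Iio r, len q ≤ t % W) (h : t % W ≤ t' % W) : r ≤ s t' := by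
  by_contra hlt
  have h2 : ∑ q ∈ Finset.Iic (s t'), len q ≤ ∑ q ∈ Finset.Iio r, len q :=
    Finset.sum_le_sum_of_subset fun q hq => by
      simp only [Finset.mem_Iic, Finset.mem_Iio] at hq ⊢
      exact hq.trans_lt (not_le.mp hlt)
  have := (hlen t').2
  omega

theorem le_block {len : Fin R → ℕ} (hlen : ∀ t, ∑ q ∈ Finset.Iio (s t), len q ≤ t % W ∧
    t % W < ∑ q ∈ Finset.Iic (s t), len q) {r : Fin R} {t : ℕ}
    (h1 : t % W < ∑ q ∈ Finset.Iic r, len q) : s t ≤ r := by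
  by_contra hlt
  have h2 : ∑ q ∈ Finset.Iic r, len q ≤ ∑ q ∈ Finset.Iio (s t), len q :=
    Finset.sum_le_sum_of_subset fun q hq => by
      simp only [Finset.mem_Iic, Finset.mem_Iio] at hq ⊢
      exact hq.trans_lt (not_le.mp hlt)
  have := (hlen t).1
  omega

theorem IsTimeSharing.mod_eq (hs : IsTimeSharing W x s) (t : ℕ) : s (t % W) = s t := by
  obtain ⟨len, -, -, hlen⟩ := hs
  apply le_antisymm
  · exact block_le hlen (hlen (t % W)).1 (Nat.mod_mod t W).le
  · exact block_le hlen (hlen t).1 (Nat.mod_mod t W).ge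

theorem sum_window {len : Fin R → ℕ} (hW : ∑ r, len r = W)
    (hlen : ∀ t, ∑ q ∈ Finset.Iio (s t), len q ≤ t % W ∧ t % W < ∑ q ∈ Finset.Iic (s t), len q)
    (c : Fin R → ℝ) : ∑ t ∈ Finset.range W, c (s t) = ∑ r, len r * c r := by
  rw [← Finset.sum_fiberwise (Finset.range W) s]
  refine Finset.sum_congr rfl fun r _ => ?_
  have h1 : (Finset.range W).filter (fun t => s t = r) =
      Finset.Ico (∑ q ∈ Finset.Iio r, len q) (∑ q ∈ Finset.Iic r, len q) := by
    ext t
    simp only [Finset.mem_filter, Finset.mem_range, Finset.mem_Ico]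
    constructor
    · rintro ⟨ht, rfl⟩
      have := hlen t
      rwa [Nat.mod_eq_of_lt ht] at this
    · rintro ⟨ha, hb⟩
      have ht : t < W := hb.trans_le (hW ▸ Finset.sum_le_univ_sum_of_nonneg fun _ => Nat.zero_le _)
      rw [← Nat.mod_eq_of_lt ht] at ha hb
      exact ⟨ht, le_antisymm (le_block hlen hb) (block_le hlen ha le_rfl)⟩
  have h2 : ∑ q ∈ Finset.Iic r, len q = ∑ q ∈ Finset.Iio r, len q + len r := by
    rw [← Finset.Iio_insert, Finset.sum_insert (by simp), add_comm]
  rw [Finset.sum_congr rfl fun t ht => by rw [(Finset.mem_filter.mp ht).2], Finset.sum_const, h1,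
    Nat.card_Ico, h2, Nat.add_sub_cancel_left, nsmul_eq_mul]

/-- Block numbers do not decrease within a window, so each change inside it is determined by the
block being left. One more change may occur on passing to the next window. -/
theorem IsTimeSharing.card_switch_le (hs : IsTimeSharing W x s) (hW : 1 ≤ W) :
    ((Finset.range W).filter fun t => s t ≠ s (t + 1)).card ≤ R + 1 := by
  obtain ⟨len, -, -, hlen⟩ := hs
  have hmono : ∀ t t', t ≤ t' → t' < W → s t ≤ s t' := fun t t' h h' =>
    block_le hlen (hlen t).1 (by
      rwa [Nat.mod_eq_of_lt (h.trans_lt h'), Nat.mod_eq_of_lt h'])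
  have hinj : Set.InjOn s ((Finset.range (W - 1)).filter fun t => s t ≠ s (t + 1)) := by
    have key : ∀ t t', t < t' → t' < W - 1 → s t ≠ s (t + 1) → s t ≠ s t' := by
      intro t t' h h' hne heq
      exact hne (le_antisymm (hmono _ _ (Nat.le_succ t) (by omega))
        (heq ▸ hmono (t + 1) t' h (by omega)))
    intro t ht t' ht' heq
    simp only [Finset.coe_filter, Finset.mem_range, Set.mem_ofPred_eq] at ht ht'
    rcases lt_trichotomy t t' with h | h | h
    · exact absurd heq (key t t' h ht'.1 ht.2)
    · exact h
    · exact absurd heq.symm (key t' t h ht.1 ht'.2)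
  have h1 := Finset.card_le_card_of_injOn s (t := Finset.univ) (fun _ _ => Finset.mem_univ _) hinj
  rw [Finset.card_univ, Fintype.card_fin] at h1
  obtain ⟨V, rfl⟩ : ∃ V, W = V + 1 := ⟨W - 1, by omega⟩
  rw [Nat.add_sub_cancel] at h1
  rw [Finset.range_add_one, Finset.filter_insert]
  split_ifs
  · exact (Finset.card_insert_le _ _).trans (by omega)
  · omega

theorem sum_range_mul_of_periodic {f : ℕ → ℝ} (hf : ∀ t, f (t + W) = f t) (k : ℕ) :
    ∑ t ∈ Finset.range (k * W), f t = k * ∑ t ∈ Finset.range W, f t := by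
  have h : ∀ k t, f (k * W + t) = f t := by
    intro k t
    induction k with
    | zero => simp
    | succ k ih => rw [← ih, ← hf (k * W + t)]; congr 1; ring
  induction k with
  | zero => simp
  | succ k ih =>
    rw [Nat.succ_mul, Finset.sum_range_add, ih]
    simp only [h]
    push_cast
    ring

/-- The average of a sequence that is described by a bounded potential `v` and, within the blocks of
a time-sharing scheme, by potentials bounded by `U`. -/
theorem IsTimeSharing.abs_sub_le (hs : IsTimeSharing W x s) (hW : 1 ≤ W) {y v : ℕ → ℝ} {C H : ℝ}
    (hv : ∀ t, |v t| ≤ H) (hy : ∀ t, y t + v (t + 1) - v t = C) {u : Fin R → ℕ → ℝ} {U : ℝ}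
    (hu : ∀ r t, |u r t| ≤ U) {c : Fin R → ℝ}
    (hyu : ∀ t, y t + u (s t) (t + 1) - u (s t) t = c (s t)) :
    |C - ∑ r, x r * c r| ≤ (2 * U * (R + 1) + ∑ r, |c r|) / W := by
  have hU : 0 ≤ U := (abs_nonneg _).trans (hu (s 0) 0)
  have hper : ∀ t, s (t + W) = s t := fun t => by
    rw [← hs.mod_eq (t + W), ← hs.mod_eq t, Nat.add_mod_right]
  have hsw := hs.card_switch_le hW
  obtain ⟨len, hlW, hlx, hlen⟩ := hs
  have h1 : ∀ n : ℕ, ∑ t ∈ Finset.range n, y t = n * C - v n + v 0 := by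
    intro n
    induction n with
    | zero => simp
    | succ n ih =>
      rw [Finset.sum_range_succ, ih]
      push_cast
      linarith [hy n]
  set sw : ℕ → ℝ := fun t => if s t ≠ s (t + 1) then 1 else 0 with hswdef
  -- The sum telescopes except where the code changes, and exchanging one potential for another
  -- costs at most `2 * U`.
  have h2 : ∀ n : ℕ, |∑ t ∈ Finset.range n, (y t - c (s t)) + u (s n) n - u (s 0) 0| ≤
      2 * U * ∑ t ∈ Finset.range n, sw t := by
    intro n
    induction n with
    | zero => simp
    | succ n ih =>
      rw [Finset.sum_range_succ, Finset.sum_range_succ, mul_add]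
      have h3 : |u (s (n + 1)) (n + 1) - u (s n) (n + 1)| ≤ 2 * U * sw n := by
        by_cases h : s n = s (n + 1)
        · simp [hswdef, h]
        · have a1 := abs_le.mp (hu (s (n + 1)) (n + 1))
          have a2 := abs_le.mp (hu (s n) (n + 1))
          simp only [hswdef, ne_eq, h, not_false_eq_true, if_true]
          rw [abs_le]
          constructor <;> linarith
      have h4 := hyu n
      refine le_trans (le_of_eq ?_) ((abs_add_le _ _).trans (add_le_add ih h3))
      congr 1
      linarith
  have hswsum : ∑ t ∈ Finset.range W, sw t ≤ R + 1 := by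
    rw [hswdef, Finset.sum_boole]
    exact_mod_cast hsw
  have h3 : ∀ k : ℕ, k * |W * C - ∑ r, len r * c r| ≤
      2 * H + 2 * U + k * (2 * U * (R + 1)) := by
    intro k
    have e1 := h2 (k * W)
    rw [Finset.sum_sub_distrib, h1, sum_range_mul_of_periodic (f := sw)
      (fun t => by simp only [hswdef, hper, show t + W + 1 = t + 1 + W by ring]),
      sum_range_mul_of_periodic (f := fun t => c (s t)) (fun t => by simp only [hper]),
      sum_window hlW hlen] at e1
    have a1 := abs_le.mp (hv (k * W))
    have a2 := abs_le.mp (hv 0)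
    have a3 := abs_le.mp (hu (s (k * W)) (k * W))
    have a4 := abs_le.mp (hu (s 0) 0)
    have a5 : 2 * U * (k * ∑ t ∈ Finset.range W, sw t) ≤ k * (2 * U * (R + 1)) := by
      calc _ = k * (2 * U * ∑ t ∈ Finset.range W, sw t) := by ring
        _ ≤ _ := by gcongr
    have a6 := abs_le.mp (e1.trans a5)
    push_cast at a6
    rw [← abs_of_nonneg (Nat.cast_nonneg (α := ℝ) k), ← abs_mul, abs_of_nonneg
      (Nat.cast_nonneg (α := ℝ) k), abs_le, mul_sub]
    constructor <;> nlinarith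
  -- The boundary term `2 * H + 2 * U` does not grow with the number `k` of windows, so `H` drops
  -- out as `k` grows.
  have h4 : |W * C - ∑ r, len r * c r| ≤ 2 * U * (R + 1) := by
    by_contra hlt
    rw [not_le] at hlt
    obtain ⟨k, hk⟩ := exists_nat_gt ((2 * H + 2 * U) /
      (|W * C - ∑ r, len r * c r| - 2 * U * (R + 1)))
    rw [div_lt_iff₀ (by linarith)] at hk
    have := h3 k
    nlinarith
  have hW' : (0 : ℝ) < W := by exact_mod_cast hW
  -- Rounding changes each block length by less than one slot.
  have h5 : |∑ r, len r * c r - W * ∑ r, x r * c r| ≤ ∑ r, |c r| := by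
    rw [Finset.mul_sum, ← Finset.sum_sub_distrib]
    refine (Finset.abs_sum_le_sum_abs _ _).trans (Finset.sum_le_sum fun r _ => ?_)
    rw [show len r * c r - W * (x r * c r) = (len r - x r * W) * c r by ring, abs_mul]
    exact mul_le_of_le_one_left (abs_nonneg _) (hlx r).le
  rw [le_div_iff₀ hW']
  calc |C - ∑ r, x r * c r| * W = |(C - ∑ r, x r * c r) * W| := by
        rw [abs_mul, abs_of_pos hW']
    _ =
      |(W * C - ∑ r, len r * c r) + (∑ r, len r * c r - W * ∑ r, x r * c r)| := by
        congr 1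
        ring
    _ ≤ _ := (abs_add_le _ _).trans (add_le_add h4 h5)

end TimeSharing

variable {Ω : Type*} [MeasurableSpace Ω] {μ : Measure Ω} {E : ℕ × Fin 2 → Ω → Bool}

/-- The claim on time sharing for codes with the thresholds `η r`. -/
def TimeSharingLimits (μ : Measure Ω) (E : ℕ × Fin 2 → Ω → Bool) {R : ℕ} (η : Fin R → Fin 2 → ℕ)
    (x : Fin R → ℝ) (s : ℕ → ℕ → Fin R) : Prop :=
  ∃ τ σ : Fin R → Fin 2 → ℝ,
    (∀ r i, HasThroughput μ E (fun _ => multicast (η r 0) (η r 1)) i (τ r i) ∧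
      HasSmoothness μ E (fun _ => multicast (η r 0) (η r 1)) i (σ r i)) ∧
    ∃ T S : ℕ → Fin 2 → ℝ,
      (∀ W, 1 ≤ W → ∀ i,
        HasThroughput μ E (fun t => multicast (η (s W t) 0) (η (s W t) 1)) i (T W i) ∧
        HasSmoothness μ E (fun t => multicast (η (s W t) 0) (η (s W t) 1)) i (S W i)) ∧
      ∀ i, Tendsto (fun W => (T W i, S W i)) atTop
        (𝓝 (∑ r, x r * τ r i, ∑ r, x r * σ r i))

theorem timeSharingLimits_of_forall {R : ℕ} {η : Fin R → Fin 2 → ℕ} {x : Fin R → ℝ}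
    (hx1 : ∑ r, x r = 1) (s : ℕ → ℕ → Fin R) {c : ℝ}
    (h : ∀ (θ : ℕ → Fin R) i,
      HasThroughput μ E (fun t => multicast (η (θ t) 0) (η (θ t) 1)) i c ∧
      HasSmoothness μ E (fun t => multicast (η (θ t) 0) (η (θ t) 1)) i c) :
    TimeSharingLimits μ E η x s := by
  refine ⟨fun _ _ => c, fun _ _ => c, fun r i => h (fun _ => r) i, fun _ _ => c, fun _ _ => c,
    fun W _ i => h (s W) i, fun i => ?_⟩
  rw [← Finset.sum_mul, hx1, one_mul]
  exact tendsto_const_nhds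

variable [IsProbabilityMeasure μ] {p : Fin 2 → ℝ} {G : ℕ}

/-- The equation is required only for the thresholds of slot `t`. It therefore serves both the
potential of the running scheme and that of the single code used in this slot, along the same
trajectory. -/
theorem IsErasureChannel.integral_potential {θ : ℕ → Fin 2 → ℕ} (hE : IsErasureChannel μ p E)
    (hG : 1 ≤ G) (hθG : ∀ t i, θ t i ≤ G) (t : ℕ) {f : State → (Fin 2 → Bool) → ℝ}
    {h h' : State → ℝ} {c : ℝ}
    (hh : ∀ s, s.2.1 ≤ G → ∑ e, weight p e * (f s e + h' (s.next (θ t) e) - h s - c) = 0) :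
    ∫ ω, f (State.run θ (fun a => E a ω) t) (fun i => E (t, i) ω) ∂μ +
      ∫ ω, h' (State.run θ (fun a => E a ω) (t + 1)) ∂μ -
      ∫ ω, h (State.run θ (fun a => E a ω) t) ∂μ = c := by
  have h0 := hE.integral_run hG hθG t hh (f := fun _ => 1) fun _ _ _ => rfl
  have i1 := hE.integrable_of_dependsBefore (dependsBefore_slot θ t f)
  have i2 := hE.integrable_of_dependsBefore (dependsBefore_slot θ t fun s e => h' (s.next (θ t) e))
  have i3 := hE.integrable_of_dependsBefore (dependsBefore_slot θ t fun s _ => h s)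
  simp only [one_mul] at h0
  have h3 := integral_sub ((i1.add i2).sub i3) (integrable_const c)
  have h1 := integral_sub (i1.add i2) i3
  have h2 := integral_add i1 i2
  simp only [Pi.add_apply, Pi.sub_apply] at h1 h2 h3
  rw [h3, h1, h2, integral_const] at h0
  simp only [probReal_univ, smul_eq_mul, one_mul] at h0
  change _ + ∫ ω, h' ((State.run θ (fun a => E a ω) t).next (θ t) fun i => E (t, i) ω) ∂μ - _ = c
  linarith

/-- The bound `U` on the potentials of the single codes does not depend on `W`. The bound on the
potential of the scheme may, but it does not enter the final estimate. -/
theorem tendsto_timeSharing (hE : IsErasureChannel μ p E) (hG : 1 ≤ G) {R : ℕ}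
    {η : Fin R → Fin 2 → ℕ} (hηG : ∀ r i, η r i ≤ G) {x : Fin R → ℝ} {s : ℕ → ℕ → Fin R}
    (hs : ∀ W, 1 ≤ W → IsTimeSharing W x (s W))
    {ρ : (Fin 2 → ℕ) → State → (Fin 2 → Bool) → ℕ} {c : Fin R → ℝ}
    (hc : ∀ r, HasPoisson p G ρ (fun _ => η r) (c r)) {C : ℕ → ℝ}
    (hC : ∀ W, 1 ≤ W → HasPoisson p G ρ (fun t => η (s W t)) (C W)) :
    Tendsto C atTop (𝓝 (∑ r, x r * c r)) := by
  choose g H hH hg using hc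
  obtain ⟨U, hU⟩ := (Set.finite_range H).bddAbove
  have hbound : ∀ (h : State → ℝ) (B : ℝ), (∀ s, s.2.1 ≤ G → |h s| ≤ B) → ∀ W t,
      |∫ ω, h (State.run (fun t => η (s W t)) (fun a => E a ω) t) ∂μ| ≤ B := by
    intro h B hB W t
    have := norm_integral_le_of_norm_le_const (μ := μ) (C := B)
      (f := fun ω => h (State.run (fun t => η (s W t)) (fun a => E a ω) t))
      (ae_of_all _ fun ω => hB _ (State.run_card_le hG (fun t i => hηG _ i) _ t))
    simpa using this
  have key : ∀ W, 1 ≤ W → |C W - ∑ r, x r * c r| ≤ (2 * U * (R + 1) + ∑ r, |c r|) / W := by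
    intro W hW
    obtain ⟨h, B, hB, hh⟩ := hC W hW
    refine (hs W hW).abs_sub_le hW
      (y := fun t => ∫ ω, (ρ (η (s W t)) (State.run (fun t => η (s W t)) (fun a => E a ω) t)
        (fun i => E (t, i) ω) : ℝ) ∂μ)
      (v := fun t => ∫ ω, h t (State.run (fun t => η (s W t)) (fun a => E a ω) t) ∂μ)
      (H := B) (fun t => hbound _ _ (hB t) W t) (fun t => ?_)
      (u := fun r t => ∫ ω, g r t (State.run (fun t => η (s W t)) (fun a => E a ω) t) ∂μ)
      (fun r t => (hbound _ _ (hH r t) W t).trans (hU ⟨r, rfl⟩)) (fun t => ?_)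
    · exact hE.integral_potential hG (fun t i => hηG _ i) t
        (f := fun s' e => (ρ (η (s W t)) s' e : ℝ)) (hh t)
    · exact hE.integral_potential (θ := fun t => η (s W t)) hG (fun t i => hηG _ i) t
        (f := fun s' e => (ρ (η (s W t)) s' e : ℝ)) (hg (s W t) t)
  rw [tendsto_iff_norm_sub_tendsto_zero]
  refine squeeze_zero' (Eventually.of_forall fun _ => norm_nonneg _)
    (eventually_atTop.mpr ⟨1, key⟩) (tendsto_const_div_atTop_nhds_zero_nat _)

variable {R : ℕ} {η : Fin R → Fin 2 → ℕ} {x : Fin R → ℝ} {s : ℕ → ℕ → Fin R}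

theorem timeSharingLimits_of_never (hE : IsErasureChannel μ p E) (hG : 1 ≤ G)
    (hη1 : ∀ r i, 1 ≤ η r i) (hηG : ∀ r i, η r i ≤ G) (hx1 : ∑ r, x r = 1) {b : Fin 2}
    (hb : p b = 0) : TimeSharingLimits μ E η x s := by
  have hae : ∀ᵐ ω ∂μ, ∀ t, E (t, b) ω = false := by
    rw [ae_all_iff]
    intro t
    have h := hE.prob t b
    rw [hb, measureReal_eq_zero_iff] at h
    filter_upwards [measure_eq_zero_iff_ae_notMem.mp h] with ω hω
    simpa using hω
  have hle : ∀ (θ : ℕ → Fin R) i, ∀ᵐ ω ∂μ, ∀ n, (requiredAfter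
      (fun t => multicast (η (θ t) 0) (η (θ t) 1)) (fun a => E a ω) i n : ℝ) ≤ (G + 1 : ℕ) := by
    intro θ i
    filter_upwards [hae] with ω hω n
    exact_mod_cast requiredAfter_le_of_never (θ := fun t => η (θ t)) hG (fun t i => hη1 _ i)
      (fun t i => hηG _ i) (x := fun a => E a ω) hω i n
  have hboth : ∀ (θ : ℕ → Fin R) i,
      HasThroughput μ E (fun t => multicast (η (θ t) 0) (η (θ t) 1)) i 0 ∧
      HasSmoothness μ E (fun t => multicast (η (θ t) 0) (η (θ t) 1)) i 0 := by
    intro θ i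
    constructor
    · refine tendstoInMeasure_of_ae_abs_le (K := (G + 1 : ℕ)) ?_
      filter_upwards [hle θ i] with ω hω n
      rw [mul_zero, sub_zero, abs_of_nonneg (Nat.cast_nonneg _)]
      exact hω n
    · refine tendstoInMeasure_of_ae_abs_le (K := (G + 1 : ℕ)) ?_
      filter_upwards [hle θ i] with ω hω n
      rw [mul_zero, sub_zero, abs_of_nonneg (Finset.sum_nonneg fun k _ => by split_ifs <;> simp)]
      exact (sum_increase_le _ (requiredAfter_mono _ _ _) n).trans (hω n)
  exact timeSharingLimits_of_forall hx1 s hboth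

theorem timeSharingLimits_of_always (hE : IsErasureChannel μ p E)
    (hη1 : ∀ r i, 1 ≤ η r i) (hx1 : ∑ r, x r = 1) (hp1 : ∀ i, p i = 1) :
    TimeSharingLimits μ E η x s := by
  have hae : ∀ᵐ ω ∂μ, ∀ t i, E (t, i) ω = true := by
    rw [ae_all_iff]
    intro t
    rw [ae_all_iff]
    intro i
    have h := hE.prob t i
    rw [hp1 i] at h
    have hm : MeasurableSet {ω | E (t, i) ω = true} :=
      hE.measurable (t, i) (measurableSet_singleton _)
    have h2 := probReal_compl_eq_one_sub (μ := μ) hm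
    rw [h, sub_self, measureReal_eq_zero_iff] at h2
    filter_upwards [measure_eq_zero_iff_ae_notMem.mp h2] with ω hω
    simpa using hω
  have heq : ∀ (θ : ℕ → Fin R) i, ∀ᵐ ω ∂μ, ∀ n, requiredAfter
      (fun t => multicast (η (θ t) 0) (η (θ t) 1)) (fun a => E a ω) i n = n + 1 := by
    intro θ i
    filter_upwards [hae] with ω hω n
    exact requiredAfter_of_always (θ := fun t => η (θ t)) (fun t i => hη1 _ i)
      (x := fun a => E a ω) hω i n
  have hboth : ∀ (θ : ℕ → Fin R) i,
      HasThroughput μ E (fun t => multicast (η (θ t) 0) (η (θ t) 1)) i 1 ∧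
      HasSmoothness μ E (fun t => multicast (η (θ t) 0) (η (θ t) 1)) i 1 := by
    intro θ i
    constructor
    · refine tendstoInMeasure_of_ae_abs_le (K := 1) ?_
      filter_upwards [heq θ i] with ω hω n
      rw [hω n]
      simp
    · refine tendstoInMeasure_of_ae_abs_le (K := 0) ?_
      filter_upwards [heq θ i] with ω hω n
      simp [hω]
  exact timeSharingLimits_of_forall hx1 s hboth

theorem timeSharingLimits_of_pos (hE : IsErasureChannel μ p E) (hG : 1 ≤ G)
    (hη1 : ∀ r i, 1 ≤ η r i) (hηG : ∀ r i, η r i ≤ G)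
    (hs : ∀ W, 1 ≤ W → IsTimeSharing W x (s W)) (hp : ∀ i, 0 < p i) {b : Fin 2}
    (hb : p b < 1) : TimeSharingLimits μ E η x s := by
  have hsingle := fun r => hasPoisson_of_periodic hp (fun i => (hE.prob_mem i).2) hb hG
    le_rfl (θ := fun _ => η r) (fun _ i => hη1 r i) (fun _ i => hηG r i) (fun _ => rfl)
  have hshare := fun W (hW : 1 ≤ W) => hasPoisson_of_periodic hp (fun i => (hE.prob_mem i).2) hb
    hG hW (θ := fun t => η (s W t)) (fun _ i => hη1 _ i) (fun _ i => hηG _ i)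
    (fun t => by rw [(hs W hW).mod_eq])
  -- At or above the threshold the lagger's packet is sent, so joint reception is a lag gain; this
  -- gives the positive rate needed for the throughput.
  have hlag : ∀ K : ℕ, ∀ θ : Fin 2 → ℕ, θ (other b) ≤ K →
      lagGain θ (other b, K, false) (fun _ => true) = 1 := fun K θ h => by simp [lagGain, h]
  have hshare' : ∀ ρ, ∃ C : ℕ → ℝ, ∀ W, 1 ≤ W →
      HasPoisson p G ρ (fun t => η (s W t)) (C W) := by
    intro ρ
    refine ⟨fun W => if hW : 1 ≤ W then (hshare W hW ρ).choose else 0, fun W hW => ?_⟩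
    beta_reduce
    rw [dif_pos hW]
    exact (hshare W hW ρ).choose_spec.1
  choose c hc using fun ρ r => (hsingle r ρ)
  choose C hC using hshare'
  refine ⟨fun r _ => c frontGain r, fun r i => c (gain i) r, fun r i => ⟨?_, ?_⟩,
    fun W _ => C frontGain W, fun W i => C (gain i) W, fun W hW i => ⟨?_, ?_⟩, fun i => ?_⟩
  · exact hasThroughput_of_hasPoisson (θ := fun _ => η r) i (hc frontGain r).1 (hc lagGain r).1
      ((hc lagGain r).2 hlag) hE hG (fun _ i => hη1 r i) (fun _ i => hηG r i)
  · exact hasSmoothness_of_hasPoisson (θ := fun _ => η r) (hc (gain i) r).1 hE hG (fun _ i => hη1 r i)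
      (fun _ i => hηG r i)
  · obtain ⟨l, hl, hl0⟩ := hshare W hW lagGain
    exact hasThroughput_of_hasPoisson (θ := fun t => η (s W t)) i (hC frontGain W hW) hl (hl0 hlag) hE hG
      (fun _ i => hη1 _ i) (fun _ i => hηG _ i)
  · exact hasSmoothness_of_hasPoisson (θ := fun t => η (s W t)) (hC (gain i) W hW) hE hG (fun _ i => hη1 _ i)
      (fun _ i => hηG _ i)
  · exact (tendsto_timeSharing hE hG hηG hs (fun r => (hc frontGain r).1) (hC frontGain)).prodMk_nhds
      (tendsto_timeSharing hE hG hηG hs (fun r => (hc (gain i) r).1) (hC (gain i)))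

end InOrderMulticast

theorem claim5 {Ω : Type*} [MeasurableSpace Ω] (μ : Measure Ω) [IsProbabilityMeasure μ]
    (p : Fin 2 → ℝ) (E : ℕ × Fin 2 → Ω → Bool) (hE : IsErasureChannel μ p E)
    {R : ℕ} (N M : Fin R → ℕ) (hN : ∀ r, 1 ≤ N r) (hM : ∀ r, 1 ≤ M r)
    (x : Fin R → ℝ) (hx : ∀ r, 0 ≤ x r ∧ x r ≤ 1) (hx1 : ∑ r, x r = 1)
    (s : ℕ → ℕ → Fin R) (hs : ∀ W, 1 ≤ W → IsTimeSharing W x (s W)) :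
    ∃ τ σ : Fin R → Fin 2 → ℝ,
      (∀ r i, HasThroughput μ E (fun _ => multicast (N r) (M r)) i (τ r i) ∧
        HasSmoothness μ E (fun _ => multicast (N r) (M r)) i (σ r i)) ∧
      ∃ T S : ℕ → Fin 2 → ℝ,
        (∀ W, 1 ≤ W → ∀ i,
          HasThroughput μ E (fun t => multicast (N (s W t)) (M (s W t))) i (T W i) ∧
          HasSmoothness μ E (fun t => multicast (N (s W t)) (M (s W t))) i (S W i)) ∧
        ∀ i, Tendsto (fun W => (T W i, S W i)) atTop
          (𝓝 (∑ r, x r * τ r i, ∑ r, x r * σ r i)) := by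
  set η : Fin R → Fin 2 → ℕ := fun r => ![N r, M r] with hη
  have hη1 : ∀ r i, 1 ≤ η r i := fun r i => by
    fin_cases i
    · exact hN r
    · exact hM r
  obtain ⟨G, hG, hηG⟩ : ∃ G, 1 ≤ G ∧ ∀ r i, η r i ≤ G := by
    obtain ⟨G, hG⟩ := (Set.finite_range fun q : Fin R × Fin 2 => η q.1 q.2).bddAbove
    exact ⟨max G 1, le_max_right _ _, fun r i => (hG ⟨(r, i), rfl⟩).trans (le_max_left _ _)⟩
  change TimeSharingLimits μ E η x s
  -- If a user never receives, the bound on the holes stops both users and all limits are `0`; if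
  -- both always receive, all limits are `1`.
  by_cases h0 : ∃ b, p b = 0
  · obtain ⟨b, hb⟩ := h0
    exact timeSharingLimits_of_never hE hG hη1 hηG hx1 hb
  have hp : ∀ i, 0 < p i := fun i => lt_of_le_of_ne (hE.prob_mem i).1 fun h => h0 ⟨i, h.symm⟩
  by_cases h1 : ∃ b, p b < 1
  · obtain ⟨b, hb⟩ := h1
    exact timeSharingLimits_of_pos hE hG hη1 hηG hs hp hb
  · exact timeSharingLimits_of_always hE hη1 hx1 fun i =>
      le_antisymm (hE.prob_mem i).2 (not_lt.mp fun h => h1 ⟨i, h⟩)
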